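/- **Model.** A constant product pool holds reserves $y_A,y_B>0$ of two assets with external prices $p_A,p_B>0$, and charges a proportional fee $f\ge 0$. Put $L_B=y_Bp_B$ and $O=\frac{y_Bp_B}{y_Ap_A(1+f)}$, and assume $1<O\le 3$. For a gas fee $g$ and trading amounts $d,\bar d\ge 0$ let $$R_F(g,d)=d\Big(\frac{y_B}{y_A+d}p_B-(1+f)p_A\Big)-g,\qquad V(d;\bar d)=\Big[\frac{d}{y_A+d}-\frac{d\,y_A}{(y_A+\bar d)(y_A+\bar d+d)}\Big]y_Bp_B,$$ $$R_S(g,d;\bar d)=R_F(g,d)-V(d;\bar d),\qquad \hat D_A=(\sqrt O-1)y_A,\qquad \hat g_H=L_B(1-O^{-1/2})^2 .$$ Let $0\le \hat g_L<\hat g_H$ be the base gas fee. Each of two arbitrageurs uses a mixed strategy $(\alpha,\mu)$: she trades with probability $\alpha\in[0,1]$ and, if she trades, draws (gas fee, trading amount) from a probability measure $\mu$ on $[\hat g_L,\hat g_H]\times[0,\hat D_A]$. The payoff of $(\alpha,\mu)$ against $(\bar\alpha,\bar\mu)$ is $$\Pi(\alpha,\mu;\bar\alpha,\bar\mu)=\alpha(1-\bar\alpha)\int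 R_F\,d\mu+\alpha\bar\alpha\iint r\big((g,d),(\bar g,\bar d)\big)\,\mu(dg\,dd)\,\bar\mu(d\bar g\,d\bar d),$$ where $r$ equals $R_F(g,d)$ if $g>\bar g$, $\frac12(R_F(g,d)+R_S(g,d;\bar d))$ if $g=\bar g$, and $R_S(g,d;\bar d)$ if $g<\bar g$. A strategy $(\alpha^*,\mu^*)$ is a symmetric mixed Nash equilibrium if it maximizes $\Pi(\cdot\,;\alpha^*,\mu^*)$ over all mixed strategies. Let $\mathcal A$ be the set of triples $(\alpha,\Phi,D_A)$ such that $\alpha\in(0,1]$, $\Phi$ is a probability measure with a continuous density on its support $[\hat g_L,g_H]$ for some $g_H\in(\hat g_L,\hat g_H]$, and $D_A:[\hat g_L,\hat g_H]\to[0,\hat D_A]$ is continuous on that support; such a triple stands for $(\alpha,\mu)$ with $\mu$ the image of $\Phi$ under $g\mapsto(g,D_A(g))$. For $(\alpha^*,\Phi^*,D_A^*)\in\mathcal A$ let $(\tilde g,\tilde D)$ be $(0,0)$ with probability $1-\alpha^*$ and, with probability $\alpha^*$, have the law of $(g,D_A^*(g))$ with $g\sim\Phi^*$. Put $F_{\tilde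 g}(g)=\mathbb P(\tilde g>g)$ and $F_{\tilde D/y_A}(d)=\mathbb P(\tilde D/y_A>d)$. The expected profit is $\Pi(\alpha^*,\mu^*;\alpha^*,\mu^*)$. Finally, let $\hat Q(x)=(1+x)^{-2}-O^{-1}$, $$K(x,\bar x)=\frac{2(1+x)(1+\bar x)(1+2\bar x)+\bar x(1+\bar x)(1+2\bar x)}{2\bar x(1+x)^2(1+\bar x+x)^2},\qquad v(x)=\frac{(1+x)(1+2x)}{2x^2}.$$ **Proposition.** For every $\hat g_L\in[0,\hat g_H)$ there is a symmetric mixed Nash equilibrium $(\alpha^*,\Phi^*,D_A^*)$ in $\mathcal A$, and it is unique ($D_A^*$ being determined on the support of $\Phi^*$). There is a unique $\hat z>0$ for which there is a positive continuous $\hat x$ on $[0,\hat z]$ with $\hat Q(\hat x(z))=\int_0^zK(\hat x(z),\hat x(s))\,ds$ for all $z\in[0,\hat z]$ and $\int_0^{\hat z}v(\hat x(s))\,ds=1$; and $\alpha^*=1$ if and only if $\hat g_L\le\hat g_H-L_B\hat z$, while $\alpha^*<1$ if and only if $\hat g_L>\hat g_H-L_B\hat z$. With all other parameters fixed and $\hat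 g_L$ varying in $[0,\hat g_H)$: (i) The trading probability $\alpha^*$ is decreasing in $\hat g_L$, strictly where $\alpha^*<1$: if $\hat g_L<\hat g_L'$ and $\alpha^*<1$ at $\hat g_L'$, then $\alpha^*$ is strictly smaller at $\hat g_L'$ than at $\hat g_L$. (ii) The expected profit is decreasing in $\hat g_L$, strictly where it is positive: if $\hat g_L<\hat g_L'$ and the profit at $\hat g_L$ is positive, then it is strictly smaller at $\hat g_L'$. (iii) On the set of $\hat g_L$ with $\alpha^*=1$, $F_{\tilde g}(g)$ is increasing in $\hat g_L$ for every $g$; on the set of $\hat g_L$ with $\alpha^*<1$, $F_{\tilde g}(g)$ is decreasing in $\hat g_L$ for every $g$. (iv) On the set of $\hat g_L$ with $\alpha^*=1$, $F_{\tilde D/y_A}(d)$ does not depend on $\hat g_L$ for every $d$; on the set of $\hat g_L$ with $\alpha^*<1$, $F_{\tilde D/y_A}(d)$ is decreasing in $\hat g_L$ for every $d$. Here "increasing" and "decreasing" are meant in the weak sense. -/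

import Mathlib

open MeasureTheory

noncomputable section

namespace GasGame

/-- A constant product pool of two assets `A`, `B`, with reserves `yA`, `yB`, external (CEX) prices
`pA`, `pB` and proportional trading fee `f`. -/
structure Pool where
  yA : ℝ
  yB : ℝ
  pA : ℝ
  pB : ℝ
  f : ℝ

namespace Pool

variable (P : Pool)

/-- The level of liquidity `L_B`. -/
def LB : ℝ := P.yB * P.pB

/-- The size `O` of the arbitrage opportunity. -/
def opp : ℝ := P.yB * P.pB / (P.yA * P.pA * (1 + P.f))

/-- Net profit `R_F(g, d)` of the first mover. -/
def RF (g d : ℝ) : ℝ := d * (P.yB / (P.yA + d) * P.pB - (1 + P.f) * P.pA) - g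

/-- The first-mover advantage `V(d; d')`. -/
def V (d d' : ℝ) : ℝ :=
  (d / (P.yA + d) - d * P.yA / ((P.yA + d') * (P.yA + d' + d))) * P.yB * P.pB

/-- Net profit `R_S(g, d; d')` of the second mover, when the first mover has traded `d'`. -/
def RS (g d d' : ℝ) : ℝ := P.RF g d - P.V d d'

/-- The optimal trading amount of a sure first mover, `argmax_d R_F(g, d)`. -/
def DHat : ℝ := (Real.sqrt P.opp - 1) * P.yA

/-- The highest profitable gas fee, `max_d R_F(0, d)`. -/
def gHat : ℝ := P.LB * (1 - 1 / Real.sqrt P.opp) ^ 2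

/-- Expected payoff of the action `a = (gas fee, trading amount)` against the action `b`, when both
arbitrageurs trade: the higher fee is executed first, and ties are broken by a fair coin. -/
def contest (a b : ℝ × ℝ) : ℝ :=
  if b.1 < a.1 then P.RF a.1 a.2
  else if b.1 = a.1 then (1 / 2) * P.RF a.1 a.2 + (1 / 2) * P.RS a.1 a.2 b.2
  else P.RS a.1 a.2 b.2

/-- Payoff `Π(α, μ; β, ν)` of the mixed strategy `(α, μ)` against `(β, ν)`. -/
def payoff (α : ℝ) (μ : Measure (ℝ × ℝ)) (β : ℝ) (ν : Measure (ℝ × ℝ)) : ℝ :=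
  α * (1 - β) * ∫ a, P.RF a.1 a.2 ∂μ + α * β * ∫ q, P.contest q.1 q.2 ∂(μ.prod ν)

/-- The admissible pairs (gas fee, trading amount) for base gas fee `gL`. -/
def actions (gL : ℝ) : Set (ℝ × ℝ) := Set.Icc gL P.gHat ×ˢ Set.Icc 0 P.DHat

/-- Mixed strategies: trade with probability `α`; conditionally on trading, draw the gas fee and the
trading amount from the probability measure `μ` on the admissible pairs. -/
def IsMixed (gL α : ℝ) (μ : Measure (ℝ × ℝ)) : Prop :=
  α ∈ Set.Icc (0 : ℝ) 1 ∧ IsProbabilityMeasure μ ∧ μ (P.actions gL)ᶜ = 0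

/-- Symmetric mixed Nash equilibrium. -/
def IsNash (gL α : ℝ) (μ : Measure (ℝ × ℝ)) : Prop :=
  P.IsMixed gL α μ ∧
    ∀ (β : ℝ) (ν : Measure (ℝ × ℝ)), P.IsMixed gL β ν → P.payoff β ν α μ ≤ P.payoff α μ α μ

end Pool

/-- A triple `(α, Φ, D)`: the trading probability, the distribution of the gas fee given that one
trades, and the trading amount as a function of the gas fee. -/
structure Strategy where
  α : ℝ
  Φ : Measure ℝ
  D : ℝ → ℝ

namespace Strategy

variable (S : Strategy)

/-- The joint distribution of the gas fee and the trading amount, given that one trades. -/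
def joint : Measure (ℝ × ℝ) := S.Φ.map fun g => (g, S.D g)

/-- The unconditional joint distribution of the gas fee paid and the trading amount, both being `0`
when one does not trade. -/
def law : Measure (ℝ × ℝ) :=
  ENNReal.ofReal (1 - S.α) • Measure.dirac (0, 0) + ENNReal.ofReal S.α • S.joint

/-- Decumulative distribution function of the gas fee paid. -/
def feeTail (g : ℝ) : ℝ := S.law.real {p | g < p.1}

/-- Decumulative distribution function of the relative trading amount in the pool `P`. -/
def amountTail (P : Pool) (d : ℝ) : ℝ := S.law.real {p | d < p.2 / P.yA}

/-- Expected profit when both arbitrageurs use the strategy `S`. -/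
def profit (P : Pool) : ℝ := P.payoff S.α S.joint S.α S.joint

end Strategy

/-- The class of triples in which the equilibrium is unique: `α ∈ (0, 1]`, `Φ` has a continuous
density on its support `[gL, gH]` for some `gH ∈ (gL, gHat]`, and `D` is continuous on the support.
-/
def Pool.InClass (P : Pool) (gL : ℝ) (S : Strategy) : Prop :=
  S.α ∈ Set.Ioc (0 : ℝ) 1 ∧ IsProbabilityMeasure S.Φ ∧
  (∀ g ∈ Set.Icc gL P.gHat, S.D g ∈ Set.Icc 0 P.DHat) ∧
  ∃ gH ∈ Set.Ioc gL P.gHat, S.Φ.support = Set.Icc gL gH ∧ ContinuousOn S.D (Set.Icc gL gH) ∧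
    ∃ φ : ℝ → ℝ, ContinuousOn φ (Set.Icc gL gH) ∧ (∀ g ∈ Set.Icc gL gH, 0 ≤ φ g) ∧
      S.Φ = (volume.restrict (Set.Icc gL gH)).withDensity fun g => ENNReal.ofReal (φ g)

/-- Symmetric mixed Nash equilibria in the above class. -/
def Pool.IsEquilibrium (P : Pool) (gL : ℝ) (S : Strategy) : Prop :=
  P.InClass gL S ∧ P.IsNash gL S.α S.joint

/-- `Q(x) = (1 + x)⁻² - O⁻¹`. -/
def Q (O x : ℝ) : ℝ := 1 / (1 + x) ^ 2 - 1 / O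

/-- The kernel `K(x, x')` of the equilibrium equation. -/
def K (x x' : ℝ) : ℝ :=
  (2 * (1 + x) * (1 + x') * (1 + 2 * x') + x' * (1 + x') * (1 + 2 * x')) /
    (2 * x' * (1 + x) ^ 2 * (1 + x' + x) ^ 2)

/-- `v(x) = L_B / V(yA x, yA x)`. -/
def v (x : ℝ) : ℝ := (1 + x) * (1 + 2 * x) / (2 * x ^ 2)

/-- `x` is a positive continuous solution on `[0, T]` of
`Q(x(z)) = ∫ s in 0..z, K(x(z), x(s))`. -/
def IsSolution (O T : ℝ) (x : ℝ → ℝ) : Prop :=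
  ContinuousOn x (Set.Icc 0 T) ∧ (∀ z ∈ Set.Icc 0 T, 0 < x z) ∧
    ∀ z ∈ Set.Icc 0 T, Q O (x z) = ∫ s in (0 : ℝ)..z, K (x z) (x s)

/-- `z` is the point at which the integral of `v(x(·))` over `[0, z]` reaches `1`, where `x` is the
solution of the above equation. -/
def IsZHat (O z : ℝ) : Prop :=
  0 < z ∧ ∃ x : ℝ → ℝ, IsSolution O z x ∧ ∫ s in (0 : ℝ)..z, v (x s) = 1

end GasGame

end

/-! Put `O = (1 + b)²`. Measure trading amounts in units of `yA`, and a gas fee by its distance `s`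
below the highest equilibrium fee `gH`, in units of `L_B`. A trader at distance `s` is executed
after an opponent at distance `r < s`. So, up to a constant, her payoff divided by `L_B` is `gain x
s`: the fee saved, minus the cost `x / O`, plus the revenue averaged over the amount already sold by
the opponent. That amount is `X r` with unconditional density `w r` for `r ≤ s`, and `0` with the
remaining mass. Neither the base fee nor `gH` enters `gain`.

A curve `X` with density `w` can be optimal only under two conditions. Optimality in the amount
gives the first order condition `avg w X s (invSq (X s)) = invSq b 0`. Indifference in the fee makes
the `s`-derivative of `gain` vanish at a fixed amount, hence `w = v ∘ X`. Together they are the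
equation with kernel `K` (`Q_eq_integral_iff`). Conversely, a solution is optimal in the amount
because revenue is strongly concave (`gain_le`), and its payoff is constant in `s` by an envelope
argument (`gain_eq_of_isSolution`).

The weight `v` blows up at amount `0`, so the equation is solved after a change of time. As a
function of `t = ∫ v(x)`, the probability that the opponent bids higher, the density is `1` and the
equation is a regular Volterra equation. A contraction in a weighted norm solves it, Gronwall's
inequality gives uniqueness, and inverting the time change gives `exists_solution`.

All equilibria are therefore initial pieces `[0, T]` of one universal profile `x`. At the top fee
the gain is `b² / (1 + b)² = gHat / L_B`, so trading yields `gHat - gH`. If `α = 1` the mass forces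
`T = Z`; if `α < 1` the profit is zero and `gH = gHat`. Hence `T = min Z ((gHat - gL) / L_B)`
(`IsEquilibrium.represents`), and `equilibrium_isEquilibrium` shows that this choice works. Raising
`gL` shifts the whole curve upwards when `α = 1`, and cuts off its low-fee end with the top fixed
when `α < 1`; the comparative statics follow. -/

namespace GasGame

open Set intervalIntegral

/-! ### Averages over the amounts sold earlier, and the first order condition. -/

/-- The average of `F` over the amounts `X r` traded up to `s`, with density `w`, the remaining mass
being put on the amount `0`. -/
noncomputable def avg (w X : ℝ → ℝ) (s : ℝ) (F : ℝ → ℝ) : ℝ :=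
  (1 - ∫ r in (0 : ℝ)..s, w r) * F 0 + ∫ r in (0 : ℝ)..s, w r * F (X r)

/-- `(1 + a + x)⁻²`, the marginal value of trading `x` after a trade of `a`. -/
noncomputable def invSq (x a : ℝ) : ℝ := 1 / (1 + a + x) ^ 2

/-- A lower bound for the rate of decrease of `invSq`. -/
noncomputable def slope (b : ℝ) : ℝ := 2 * (1 / (1 + 2 * b)) ^ 3

lemma slope_pos {b : ℝ} (hb : 0 < b) : 0 < slope b := by unfold slope; positivity

/-- The derivative of `(1 + a + x)⁻²` in `x` is `-2 (1 + a + x)⁻³`, and `1 ≤ 1 + a + x ≤ 1 + 2b` on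
the range considered. The two-sided bound makes the first order condition uniquely and stably
solvable. -/
lemma invSq_sub_bounds {b x x' a : ℝ} (hx : 0 ≤ x) (hxx : x ≤ x') (hx' : x' ≤ b)
    (ha : a ∈ Icc 0 b) :
    slope b * (x' - x) ≤ invSq x a - invSq x' a ∧ invSq x a - invSq x' a ≤ 2 * (x' - x) := by
  obtain ⟨ha0, hab⟩ := ha
  have hb : 0 ≤ b := ha0.trans hab
  set p := 1 / (1 + a + x) with hp
  set q := 1 / (1 + a + x') with hq
  have h1 : (0 : ℝ) < 1 + a + x := by positivity
  have h2 : (0 : ℝ) < 1 + a + x' := by linarith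
  have e : invSq x a - invSq x' a = (x' - x) * (p * q * (p + q)) := by
    simp only [invSq, hp, hq]; field_simp; ring
  have hp1 : p ≤ 1 := by rw [hp, div_le_one h1]; linarith
  have hq1 : q ≤ 1 := by rw [hq, div_le_one h2]; linarith
  have hk : 0 < 1 / (1 + 2 * b) := by positivity
  have hpk : 1 / (1 + 2 * b) ≤ p := one_div_le_one_div_of_le h1 (by linarith)
  have hqk : 1 / (1 + 2 * b) ≤ q := one_div_le_one_div_of_le h2 (by linarith)
  set k := 1 / (1 + 2 * b) with hkd
  have hd : 0 ≤ x' - x := by linarith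
  rw [e]
  constructor
  · have : k * k * (k + k) ≤ p * q * (p + q) := by gcongr
    calc slope b * (x' - x) = (x' - x) * (k * k * (k + k)) := by simp only [slope, ← hkd]; ring
      _ ≤ _ := by gcongr
  · have : p * q * (p + q) ≤ 1 * 1 * (1 + 1) := by gcongr
    nlinarith

lemma continuousOn_invSq {b x : ℝ} (hx : 0 ≤ x) : ContinuousOn (invSq x) (Icc 0 b) := by
  unfold invSq
  refine ContinuousOn.div (by fun_prop) (by fun_prop) fun a ha => ?_
  have := ha.1
  positivity

section Avg

variable {w X : ℝ → ℝ} {s b : ℝ} {F G : ℝ → ℝ}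

lemma continuous_weighted (hw : Continuous w) (hX : Continuous X) (hXb : ∀ r, X r ∈ Icc 0 b)
    (hF : ContinuousOn F (Icc 0 b)) : Continuous fun r => w r * F (X r) :=
  hw.mul (hF.comp_continuous hX hXb)

lemma avg_sub (hw : Continuous w) (hX : Continuous X) (hXb : ∀ r, X r ∈ Icc 0 b)
    (hF : ContinuousOn F (Icc 0 b)) (hG : ContinuousOn G (Icc 0 b)) :
    avg w X s F - avg w X s G = avg w X s fun a => F a - G a := by
  simp only [avg, mul_sub]
  rw [intervalIntegral.integral_sub
    ((continuous_weighted hw hX hXb hF).intervalIntegrable _ _)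
    ((continuous_weighted hw hX hXb hG).intervalIntegrable _ _)]
  ring

lemma avg_const (c : ℝ) : avg w X s (fun _ => c) = c := by
  simp only [avg, intervalIntegral.integral_mul_const]
  ring

lemma avg_mono (hw : Continuous w) (hw0 : ∀ r, 0 ≤ w r) (hX : Continuous X)
    (hXb : ∀ r, X r ∈ Icc 0 b) (hs : 0 ≤ s) (hM : ∫ r in (0 : ℝ)..s, w r ≤ 1)
    (hF : ContinuousOn F (Icc 0 b)) (hG : ContinuousOn G (Icc 0 b))
    (h : ∀ a ∈ Icc 0 b, F a ≤ G a) : avg w X s F ≤ avg w X s G := by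
  have hb : (0 : ℝ) ∈ Icc 0 b := ⟨le_rfl, (hXb 0).1.trans (hXb 0).2⟩
  have h1 : 0 ≤ 1 - ∫ r in (0 : ℝ)..s, w r := by linarith
  refine add_le_add (mul_le_mul_of_nonneg_left (h 0 hb) h1) ?_
  exact intervalIntegral.integral_mono_on hs
    ((continuous_weighted hw hX hXb hF).intervalIntegrable _ _)
    ((continuous_weighted hw hX hXb hG).intervalIntegrable _ _)
    fun r _ => mul_le_mul_of_nonneg_left (h _ (hXb r)) (hw0 r)

lemma avg_invSq_sub_bounds (hw : Continuous w) (hw0 : ∀ r, 0 ≤ w r) (hX : Continuous X)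
    (hXb : ∀ r, X r ∈ Icc 0 b) (hs : 0 ≤ s) (hM : ∫ r in (0 : ℝ)..s, w r ≤ 1)
    {x x' : ℝ} (hx : 0 ≤ x) (hxx : x ≤ x') (hx' : x' ≤ b) :
    slope b * (x' - x) ≤ avg w X s (invSq x) - avg w X s (invSq x') ∧
      avg w X s (invSq x) - avg w X s (invSq x') ≤ 2 * (x' - x) := by
  have c1 := continuousOn_invSq (b := b) hx
  have c2 := continuousOn_invSq (b := b) (hx.trans hxx)
  rw [avg_sub hw hX hXb c1 c2]
  constructor
  · rw [← avg_const (w := w) (X := X) (s := s) (slope b * (x' - x))]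
    exact avg_mono hw hw0 hX hXb hs hM continuousOn_const (c1.sub c2)
      fun a ha => (invSq_sub_bounds hx hxx hx' ha).1
  · rw [← avg_const (w := w) (X := X) (s := s) (2 * (x' - x))]
    exact avg_mono hw hw0 hX hXb hs hM (c1.sub c2) continuousOn_const
      fun a ha => (invSq_sub_bounds hx hxx hx' ha).2

/-- Stability of the root: an error in the first order condition controls the error in the amount.
This drives both the contraction and the Gronwall estimate. -/
lemma slope_mul_abs_le (hw : Continuous w) (hw0 : ∀ r, 0 ≤ w r) (hX : Continuous X)
    (hXb : ∀ r, X r ∈ Icc 0 b) (hs : 0 ≤ s) (hM : ∫ r in (0 : ℝ)..s, w r ≤ 1)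
    {x x' : ℝ} (hx : x ∈ Icc 0 b) (hx' : x' ∈ Icc 0 b) :
    slope b * |x - x'| ≤ |avg w X s (invSq x) - avg w X s (invSq x')| := by
  rcases le_total x x' with h | h
  · have := (avg_invSq_sub_bounds hw hw0 hX hXb hs hM hx.1 h hx'.2).1
    rw [abs_sub_comm x, abs_of_nonneg (sub_nonneg.2 h)]
    exact this.trans (le_abs_self _)
  · have := (avg_invSq_sub_bounds hw hw0 hX hXb hs hM hx'.1 h hx.2).1
    rw [abs_of_nonneg (sub_nonneg.2 h), abs_sub_comm]
    exact this.trans (le_abs_self _)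

lemma continuousOn_avg_invSq (hw : Continuous w) (hw0 : ∀ r, 0 ≤ w r) (hX : Continuous X)
    (hXb : ∀ r, X r ∈ Icc 0 b) (hs : 0 ≤ s) (hM : ∫ r in (0 : ℝ)..s, w r ≤ 1) :
    ContinuousOn (fun x => avg w X s (invSq x)) (Icc 0 b) := by
  have : LipschitzOnWith 2 (fun x => avg w X s (invSq x)) (Icc 0 b) := by
    refine LipschitzOnWith.of_dist_le_mul fun x hx x' hx' => ?_
    rw [Real.dist_eq, Real.dist_eq, NNReal.coe_ofNat]
    rcases le_total x x' with h | h
    · have := avg_invSq_sub_bounds hw hw0 hX hXb hs hM hx.1 h hx'.2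
      have hc : 0 ≤ slope b := by
        have := hx.1.trans hx.2
        unfold slope; positivity
      rw [abs_sub_comm x, abs_of_nonneg (sub_nonneg.2 h), abs_of_nonneg]
      · exact this.2
      · exact (mul_nonneg hc (sub_nonneg.2 h)).trans this.1
    · have := avg_invSq_sub_bounds hw hw0 hX hXb hs hM hx'.1 h hx.2
      have hc : 0 ≤ slope b := by
        have := hx.1.trans hx.2
        unfold slope; positivity
      rw [abs_sub_comm, abs_of_nonneg (sub_nonneg.2 h), abs_of_nonneg]
      · exact this.2
      · exact (mul_nonneg hc (sub_nonneg.2 h)).trans this.1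
  exact this.continuousOn

/-- The first order condition has a solution in `[0, b]`. -/
lemma exists_root (hw : Continuous w) (hw0 : ∀ r, 0 ≤ w r) (hX : Continuous X)
    (hXb : ∀ r, X r ∈ Icc 0 b) (hs : 0 ≤ s) (hM : ∫ r in (0 : ℝ)..s, w r ≤ 1) :
    ∃ x ∈ Icc 0 b, avg w X s (invSq x) = invSq b 0 := by
  have hb : 0 ≤ b := (hXb 0).1.trans (hXb 0).2
  -- Since previous amounts lie in `[0, b]`, the average marginal value is at most `invSq b 0` at `x
  -- = b` and at least `invSq b 0` at `x = 0`.
  refine intermediate_value_Icc' hb (continuousOn_avg_invSq hw hw0 hX hXb hs hM) ⟨?_, ?_⟩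
  · rw [← avg_const (w := w) (X := X) (s := s) (invSq b 0)]
    refine avg_mono hw hw0 hX hXb hs hM (continuousOn_invSq hb) continuousOn_const fun a ha => ?_
    have := ha.1
    unfold invSq
    gcongr
  · rw [← avg_const (w := w) (X := X) (s := s) (invSq b 0)]
    refine avg_mono hw hw0 hX hXb hs hM continuousOn_const (continuousOn_invSq le_rfl)
      fun a ha => ?_
    have := ha.1
    have := ha.2
    unfold invSq
    gcongr 1 / ?_ ^ 2
    linarith

/-- The dependence of the first order condition on the amounts traded before. -/
lemma abs_avg_invSq_sub_le {Y : ℝ → ℝ} (hw : Continuous w) (hw0 : ∀ r, 0 ≤ w r)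
    (hX : Continuous X) (hXb : ∀ r, X r ∈ Icc 0 b) (hY : Continuous Y) (hYb : ∀ r, Y r ∈ Icc 0 b)
    (hs : 0 ≤ s) {x : ℝ} (hx : x ∈ Icc 0 b) :
    |avg w X s (invSq x) - avg w Y s (invSq x)| ≤ 2 * ∫ r in (0 : ℝ)..s, w r * |X r - Y r| := by
  have c := continuousOn_invSq (b := b) hx.1
  have e : avg w X s (invSq x) - avg w Y s (invSq x) =
      ∫ r in (0 : ℝ)..s, (w r * invSq x (X r) - w r * invSq x (Y r)) := by
    rw [intervalIntegral.integral_sub ((continuous_weighted hw hX hXb c).intervalIntegrable _ _)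
      ((continuous_weighted hw hY hYb c).intervalIntegrable _ _)]
    simp only [avg]; ring
  rw [e, ← intervalIntegral.integral_const_mul, ← Real.norm_eq_abs]
  refine intervalIntegral.norm_integral_le_of_norm_le hs (Filter.Eventually.of_forall fun r _ => ?_)
    (Continuous.intervalIntegrable (by fun_prop) _ _)
  have key : |invSq x (X r) - invSq x (Y r)| ≤ 2 * |X r - Y r| := by
    have hc : 0 ≤ slope b := by
      have := hx.1.trans hx.2
      unfold slope; positivity
    -- By symmetry, the Lipschitz bound in one's own amount is also one in the previous amount.
    have sw : ∀ a, invSq x a = invSq a x := fun a => by unfold invSq; ring_nf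
    rw [sw, sw]
    rcases le_total (X r) (Y r) with h | h
    · have := invSq_sub_bounds (hXb r).1 h (hYb r).2 hx
      rw [abs_sub_comm (X r), abs_of_nonneg (sub_nonneg.2 h), abs_of_nonneg]
      · exact this.2
      · exact (mul_nonneg hc (sub_nonneg.2 h)).trans this.1
    · have := invSq_sub_bounds (hYb r).1 h (hXb r).2 hx
      rw [abs_sub_comm, abs_of_nonneg (sub_nonneg.2 h), abs_of_nonneg]
      · exact this.2
      · exact (mul_nonneg hc (sub_nonneg.2 h)).trans this.1
  rw [← mul_sub, Real.norm_eq_abs, abs_mul, abs_of_nonneg (hw0 r)]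
  calc w r * |invSq x (X r) - invSq x (Y r)| ≤ w r * (2 * |X r - Y r|) :=
        mul_le_mul_of_nonneg_left key (hw0 r)
    _ = _ := by ring

end Avg

/-! ### Uniqueness for a given density, and existence after the change of time. -/

/-- An integral form of Gronwall's inequality. -/
lemma eqOn_zero_of_le_integral {u : ℝ → ℝ} {C T : ℝ} (hu : Continuous u) (hu0 : ∀ r, 0 ≤ u r)
    (h : ∀ s ∈ Icc 0 T, u s ≤ C * ∫ r in (0 : ℝ)..s, u r) : ∀ s ∈ Icc 0 T, u s = 0 := by
  have hd : ∀ s, HasDerivAt (fun s => ∫ r in (0 : ℝ)..s, u r) (u s) s := fun s =>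
    hu.integral_hasStrictDerivAt 0 s |>.hasDerivAt
  have key := norm_le_gronwallBound_of_norm_deriv_right_le (f := fun s => ∫ r in (0 : ℝ)..s, u r)
    (f' := u) (δ := 0) (K := C) (ε := 0) (a := 0) (b := T)
    (fun s _ => (hd s).continuousAt.continuousWithinAt) (fun s _ => (hd s).hasDerivWithinAt)
    (by simp) (fun s hs => by
      rw [add_zero, Real.norm_eq_abs, Real.norm_eq_abs, abs_of_nonneg (hu0 s),
        abs_of_nonneg (intervalIntegral.integral_nonneg hs.1 fun r _ => hu0 r)]
      exact h s (Ico_subset_Icc_self hs))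
  intro s hs
  have := key s hs
  rw [gronwallBound_ε0_δ0] at this
  have h0 := norm_le_zero_iff.1 this
  have := h s hs
  rw [h0, mul_zero] at this
  exact le_antisymm this (hu0 s)

/-- Uniqueness for the equilibrium equation with a given density `w`. -/
lemma root_unique {w X Y : ℝ → ℝ} {b T : ℝ} (hb : 0 < b) (hw : Continuous w)
    (hw0 : ∀ r, 0 ≤ w r) (hX : Continuous X) (hXb : ∀ r, X r ∈ Icc 0 b) (hY : Continuous Y)
    (hYb : ∀ r, Y r ∈ Icc 0 b) (hM : ∀ s ∈ Icc 0 T, ∫ r in (0 : ℝ)..s, w r ≤ 1)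
    (eX : ∀ s ∈ Icc 0 T, avg w X s (invSq (X s)) = invSq b 0)
    (eY : ∀ s ∈ Icc 0 T, avg w Y s (invSq (Y s)) = invSq b 0) : EqOn X Y (Icc 0 T) := by
  obtain ⟨C, hC⟩ := isCompact_Icc.exists_bound_of_continuousOn (s := Icc 0 T) hw.continuousOn
  have key := eqOn_zero_of_le_integral (u := fun r => |X r - Y r|) (T := T)
    (C := (slope b)⁻¹ * (2 * C)) (by fun_prop) (fun _ => abs_nonneg _) fun s hs => by
      have h1 := slope_mul_abs_le hw hw0 hX hXb hs.1 (hM s hs) (hXb s) (hYb s)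
      rw [eX s hs, ← eY s hs, abs_sub_comm (avg w Y s _)] at h1
      have h2 := h1.trans (abs_avg_invSq_sub_le hw hw0 hX hXb hY hYb hs.1 (hYb s))
      have h3 : ∫ r in (0 : ℝ)..s, w r * |X r - Y r| ≤ ∫ r in (0 : ℝ)..s, C * |X r - Y r| := by
        refine intervalIntegral.integral_mono_on hs.1 (Continuous.intervalIntegrable (by fun_prop) _ _)
          (Continuous.intervalIntegrable (by fun_prop) _ _) fun r hr => ?_
        have := (le_abs_self _).trans (hC r ⟨hr.1, hr.2.trans hs.2⟩)
        gcongr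
      rw [intervalIntegral.integral_const_mul] at h3
      rw [mul_assoc, inv_mul_eq_div, le_div_iff₀ (slope_pos hb)]
      linarith
  intro s hs
  exact sub_eq_zero.1 (abs_eq_zero.1 (key s hs))

lemma invSq_mem_Icc {x a : ℝ} (hx : 0 ≤ x) (ha : 0 ≤ a) : invSq x a ∈ Icc (0 : ℝ) 1 := by
  have : 1 ≤ (1 + a + x) ^ 2 := one_le_pow₀ (by linarith)
  exact ⟨by unfold invSq; positivity, by unfold invSq; exact (div_le_one (by positivity)).2 this⟩

/-- Between `t'` and `t` the mass `|t - t'|` moves from the amount `0` to amounts `X r`, and `invSq`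
takes values in `[0, 1]`. This yields the Lipschitz bound for the root as a function of time. -/
lemma abs_avg_one_sub_le {X : ℝ → ℝ} {b : ℝ} (hX : Continuous X) (hXb : ∀ r, X r ∈ Icc 0 b)
    {x : ℝ} (hx : 0 ≤ x) (t t' : ℝ) :
    |avg (fun _ => 1) X t (invSq x) - avg (fun _ => 1) X t' (invSq x)| ≤ |t - t'| := by
  have c := continuous_weighted (w := fun _ => 1) continuous_const hX hXb
    (continuousOn_invSq (b := b) hx)
  have e : avg (fun _ => 1) X t (invSq x) - avg (fun _ => 1) X t' (invSq x) =
      ∫ r in t'..t, (1 * invSq x (X r) - invSq x 0) := by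
    rw [intervalIntegral.integral_sub (c.intervalIntegrable _ _) (by simp),
      ← intervalIntegral.integral_interval_sub_left (c.intervalIntegrable 0 t)
      (c.intervalIntegrable 0 t')]
    simp [avg]; ring
  rw [e, ← Real.norm_eq_abs]
  refine (intervalIntegral.norm_integral_le_of_norm_le_const (C := 1) fun r _ => ?_).trans (by simp)
  have h1 := invSq_mem_Icc hx (hXb r).1
  have h2 := invSq_mem_Icc hx le_rfl
  rw [one_mul, Real.norm_eq_abs, abs_le]
  constructor <;> linarith [h1.1, h1.2, h2.1, h2.2]

/-- The equilibrium equation in the variable `t = ℙ(the opponent's gas fee is higher)` has a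
solution on `[0, 1]`. -/
lemma exists_timeChanged_solution {b : ℝ} (hb : 0 < b) :
    ∃ y : ℝ → ℝ, Continuous y ∧ (∀ t t', |y t - y t'| ≤ (slope b)⁻¹ * |t - t'|) ∧
      (∀ t, y t ∈ Icc 0 b) ∧ (∀ t, y t = y (projIcc (0 : ℝ) 1 zero_le_one t)) ∧
      ∀ t ∈ Icc (0 : ℝ) 1, avg (fun _ => 1) y t (invSq (y t)) = invSq b 0 := by
  have hc := slope_pos hb
  have cone : Continuous fun _ : ℝ => (1 : ℝ) := continuous_const
  have one0 : ∀ r : ℝ, (0 : ℝ) ≤ (fun _ => (1 : ℝ)) r := fun _ => zero_le_one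
  have hM : ∀ t : Icc (0 : ℝ) 1, ∫ _ in (0 : ℝ)..t, (1 : ℝ) ≤ 1 := fun t => by simpa using t.2.2
  have H : ∀ (X : {X : ℝ → ℝ // Continuous X ∧ ∀ r, X r ∈ Icc 0 b}) (t : Icc (0 : ℝ) 1),
      ∃ x ∈ Icc 0 b, avg (fun _ => 1) X.1 t (invSq x) = invSq b 0 := fun X t =>
    exists_root cone one0 X.2.1 X.2.2 t.2.1 (hM t)
  choose ρ ρmem ρeq using H
  have ρlip : ∀ X (t t' : Icc (0 : ℝ) 1), |ρ X t - ρ X t'| ≤ (slope b)⁻¹ * |(t : ℝ) - t'| := by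
    intro X t t'
    have h1 := slope_mul_abs_le cone one0 X.2.1 X.2.2 t.2.1 (hM t) (ρmem X t) (ρmem X t')
    rw [ρeq X t, ← ρeq X t', abs_sub_comm (avg _ _ _ _)] at h1
    have h2 := h1.trans (abs_avg_one_sub_le X.2.1 X.2.2 (ρmem X t').1 _ _)
    rwa [inv_mul_eq_div, le_div_iff₀ hc, mul_comm]
  have ρcont : ∀ X, Continuous (ρ X) := fun X => by
    have : LipschitzWith (slope b)⁻¹.toNNReal (ρ X) := LipschitzWith.of_dist_le_mul fun t t' => by
      rw [Real.coe_toNNReal _ (inv_nonneg.2 hc.le), Real.dist_eq, Subtype.dist_eq, Real.dist_eq]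
      exact ρlip X t t'
    exact this.continuous
  -- Unknowns are rescaled by `exp (-l t)`. The map then has Lipschitz constant `2 / (slope b * l)`,
  -- which this `l` makes equal to `1 / 2`, so one contraction covers all of `[0, 1]`.
  set l := 4 * (slope b)⁻¹ with hl
  have hlpos : 0 < l := by positivity
  -- Undoing the rescaling may leave `[0, b]`, so the curve is clamped; at the fixed point the clamp
  -- is inactive (`extZ`).
  let ext : C(Icc (0 : ℝ) 1, ℝ) → {X : ℝ → ℝ // Continuous X ∧ ∀ r, X r ∈ Icc 0 b} := fun Z =>
    ⟨fun t => max 0 (min b (Real.exp (l * t) * Z (projIcc 0 1 zero_le_one t))),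
      by
        have : Continuous (projIcc (0 : ℝ) 1 zero_le_one) := continuous_projIcc
        fun_prop,
      fun t => ⟨le_max_left _ _, max_le hb.le (min_le_left _ _)⟩⟩
  let Tr : C(Icc (0 : ℝ) 1, ℝ) → C(Icc (0 : ℝ) 1, ℝ) := fun Z =>
    ⟨fun t => Real.exp (-(l * t)) * ρ (ext Z) t, by
      have := ρcont (ext Z)
      fun_prop⟩
  have ext_sub : ∀ Z Z' : C(Icc (0 : ℝ) 1, ℝ), ∀ t,
      |(ext Z).1 t - (ext Z').1 t| ≤ Real.exp (l * t) * dist Z Z' := by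
    intro Z Z' t
    have h1 : ∀ p q : ℝ, |max 0 (min b p) - max 0 (min b q)| ≤ |p - q| := fun p q =>
      (abs_max_sub_max_le_max 0 _ 0 _).trans (max_le (by simp)
        ((abs_min_sub_min_le_max b _ b _).trans (max_le (by simp) le_rfl)))
    refine (h1 _ _).trans ?_
    rw [← mul_sub, abs_mul, Real.abs_exp]
    gcongr
    exact ContinuousMap.dist_apply_le_dist (f := Z) (g := Z') _
  have contr : ContractingWith (1 / 2) Tr := by
    refine ⟨by rw [div_lt_one] <;> norm_num, LipschitzWith.of_dist_le_mul fun Z Z' => ?_⟩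
    rw [ContinuousMap.dist_le (by positivity)]
    intro t
    have h1 := slope_mul_abs_le cone one0 (ext Z).2.1 (ext Z).2.2 t.2.1 (hM t)
      (ρmem (ext Z) t) (ρmem (ext Z') t)
    rw [ρeq (ext Z) t, ← ρeq (ext Z') t, abs_sub_comm (avg _ _ _ _)] at h1
    have h2 := h1.trans (abs_avg_invSq_sub_le cone one0 (ext Z).2.1 (ext Z).2.2 (ext Z').2.1
      (ext Z').2.2 t.2.1 (ρmem (ext Z') t))
    have h3 : ∫ r in (0 : ℝ)..t, (1 : ℝ) * |(ext Z).1 r - (ext Z').1 r| ≤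
        ∫ r in (0 : ℝ)..t, Real.exp (l * r) * dist Z Z' := by
      have := (ext Z).2.1
      have := (ext Z').2.1
      refine intervalIntegral.integral_mono_on t.2.1
        (Continuous.intervalIntegrable (by fun_prop) _ _)
        (Continuous.intervalIntegrable (by fun_prop) _ _) fun r _ => ?_
      rw [one_mul]
      exact ext_sub Z Z' r
    have h4 : ∫ r in (0 : ℝ)..t, Real.exp (l * r) ≤ Real.exp (l * t) / l := by
      rw [intervalIntegral.integral_comp_mul_left _ hlpos.ne', integral_exp, smul_eq_mul,
        inv_mul_eq_div]
      gcongr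
      simp
    rw [intervalIntegral.integral_mul_const] at h3
    have h5 : slope b * |ρ (ext Z) t - ρ (ext Z') t| ≤
        2 * (Real.exp (l * t) / l * dist Z Z') :=
      h2.trans (by gcongr; exact h3.trans (by gcongr))
    have h6 : |ρ (ext Z) t - ρ (ext Z') t| ≤ Real.exp (l * t) * (1 / 2 * dist Z Z') := by
      rw [mul_comm, ← le_div_iff₀ hc] at h5
      refine h5.trans (le_of_eq ?_)
      rw [hl]
      field_simp
      norm_num
    change dist (Real.exp (-(l * t)) * ρ (ext Z) t) (Real.exp (-(l * t)) * ρ (ext Z') t) ≤ _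
    rw [Real.dist_eq, ← mul_sub, abs_mul, Real.abs_exp, Real.exp_neg, inv_mul_eq_div,
      div_le_iff₀ (Real.exp_pos _), mul_comm _ (Real.exp _)]
    simpa using h6
  set Z := contr.fixedPoint Tr with hZ
  have fix : Tr Z = Z := contr.fixedPoint_isFixedPt
  have extZ : ∀ t : Icc (0 : ℝ) 1, (ext Z).1 t = ρ (ext Z) t := by
    intro t
    have h1 : Z t = Real.exp (-(l * t)) * ρ (ext Z) t := by
      conv_lhs => rw [← fix]
      rfl
    change max 0 (min b (Real.exp (l * t) * Z (projIcc 0 1 zero_le_one (t : ℝ)))) = _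
    rw [projIcc_val, h1, ← mul_assoc, ← Real.exp_add, add_neg_cancel, Real.exp_zero, one_mul,
      min_eq_right (ρmem _ t).2, max_eq_right (ρmem _ t).1]
  refine ⟨fun t => ρ (ext Z) (projIcc 0 1 zero_le_one t), (ρcont _).comp continuous_projIcc,
    fun t t' => (ρlip _ _ _).trans ?_, fun t => ρmem _ _, fun t => by simp, fun t ht => ?_⟩
  · refine mul_le_mul_of_nonneg_left ?_ (inv_nonneg.2 hc.le)
    have := (LipschitzWith.projIcc (zero_le_one (α := ℝ))).dist_le_mul t t'
    simpa [Subtype.dist_eq, Real.dist_eq] using this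
  · have h1 := ρeq (ext Z) ⟨t, ht⟩
    simp only [projIcc_of_mem _ ht]
    rw [← h1]
    simp only [avg]
    congr 1
    refine intervalIntegral.integral_congr fun r hr => ?_
    rw [uIcc_of_le ht.1] at hr
    have hr' : r ∈ Icc (0 : ℝ) 1 := ⟨hr.1, hr.2.trans ht.2⟩
    simp only [projIcc_of_mem _ hr', ← extZ ⟨r, hr'⟩]

/-- At a zero of `y` the average of `invSq 0 a` would equal `invSq b 0`. Each value is at least
that, with equality only at `a = b`, while `y` stays below `b` near its zero. For `t = 0` all the
mass sits at the amount `0`. -/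
lemma timeChanged_solution_pos {b : ℝ} (hb : 0 < b) {y : ℝ → ℝ} (hy : Continuous y)
    (hyb : ∀ t, y t ∈ Icc 0 b)
    (e : ∀ t ∈ Icc (0 : ℝ) 1, avg (fun _ => 1) y t (invSq (y t)) = invSq b 0)
    {t : ℝ} (ht : t ∈ Icc (0 : ℝ) 1) : 0 < y t := by
  refine (hyb t).1.lt_of_ne' fun h0 => ?_
  have lt : ∀ a, 0 ≤ a → a < b → invSq b 0 < invSq 0 a := fun a ha hab => by
    unfold invSq
    gcongr 1 / ?_ ^ 2
    linarith
  have le : ∀ a ∈ Icc 0 b, invSq b 0 ≤ invSq 0 a := fun a ha => by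
    have := ha.1
    have := ha.2
    unfold invSq
    gcongr 1 / ?_ ^ 2
    linarith
  have c := continuousOn_invSq (b := b) (le_refl 0)
  have h1 := e t ht
  rw [h0, ← sub_eq_zero, ← avg_const (w := fun _ => 1) (X := y) (s := t) (invSq b 0),
    avg_sub continuous_const hy hyb c continuousOn_const] at h1
  have c' := continuous_weighted (w := fun _ => 1) continuous_const hy hyb
    (c.sub (continuousOn_const (c := invSq b 0)))
  have h2 : 0 ≤ (1 - ∫ _ in (0 : ℝ)..t, (1 : ℝ)) * (invSq 0 0 - invSq b 0) :=
    mul_nonneg (by simpa using ht.2) (sub_nonneg.2 (le 0 ⟨le_rfl, hb.le⟩))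
  rcases ht.1.eq_or_lt with h | h
  · subst h
    simp only [avg, integral_same, sub_zero, one_mul, add_zero] at h1
    exact (sub_pos.2 (lt 0 le_rfl hb)).ne' h1
  · have h3 := intervalIntegral.integral_pos h c'.continuousOn
      (fun r _ => mul_nonneg zero_le_one (sub_nonneg.2 (le _ (hyb r))))
      ⟨t, right_mem_Icc.2 h.le, mul_pos one_pos (sub_pos.2 (by rw [h0]; exact lt 0 le_rfl hb))⟩
    exact (add_pos_of_nonneg_of_pos h2 h3).ne' h1

/-! ### The kernel `K`, and the solution in the original variable. -/

lemma v_pos {a : ℝ} (ha : 0 < a) : 0 < v a := by unfold v; positivity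

lemma continuousOn_v : ContinuousOn v (Ioi 0) := by
  unfold v
  refine ContinuousOn.div (by fun_prop) (by fun_prop) fun a ha => ?_
  have : (0 : ℝ) < a := ha
  positivity

/-- The kernel is the density `v a` times the loss of marginal value caused by an earlier trade `a`.
-/
lemma K_eq {x a : ℝ} (hx : 0 ≤ x) (ha : 0 < a) :
    K x a = v a * (invSq x 0 - invSq x a) := by
  unfold K v invSq
  have h1 : 1 + x ≠ 0 := by positivity
  have h2 : 1 + a + x ≠ 0 := by positivity
  field_simp
  ring

lemma Q_eq_integral_iff {b x s : ℝ} {w X : ℝ → ℝ} (hx : 0 ≤ x) (hs : 0 ≤ s)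
    (hX : ContinuousOn X (Icc 0 s)) (hX0 : ∀ r ∈ Icc 0 s, 0 < X r)
    (hw : ∀ r ∈ Icc 0 s, w r = v (X r)) :
    Q ((1 + b) ^ 2) x = ∫ r in (0 : ℝ)..s, K x (X r) ↔ avg w X s (invSq x) = invSq b 0 := by
  have cv : ContinuousOn (fun r => v (X r)) (uIcc 0 s) := by
    rw [uIcc_of_le hs]
    exact continuousOn_v.comp hX fun r hr => hX0 r hr
  have ci : ContinuousOn (fun r => v (X r) * invSq x (X r)) (uIcc 0 s) := by
    refine cv.mul ?_
    rw [uIcc_of_le hs]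
    unfold invSq
    refine ContinuousOn.div (by fun_prop) (by fun_prop) fun r hr => ?_
    have := hX0 r hr
    positivity
  have e1 : ∫ r in (0 : ℝ)..s, K x (X r) =
      (∫ r in (0 : ℝ)..s, v (X r)) * invSq x 0 - ∫ r in (0 : ℝ)..s, v (X r) * invSq x (X r) := by
    have cc : ContinuousOn (fun r => v (X r) * invSq x 0) (uIcc 0 s) := cv.mul continuousOn_const
    rw [← intervalIntegral.integral_mul_const, ← intervalIntegral.integral_sub
      cc.intervalIntegrable ci.intervalIntegrable]
    refine intervalIntegral.integral_congr fun r hr => ?_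
    rw [uIcc_of_le hs] at hr
    simp only [K_eq hx (hX0 r hr), mul_sub]
  have e2 : ∫ r in (0 : ℝ)..s, w r = ∫ r in (0 : ℝ)..s, v (X r) :=
    intervalIntegral.integral_congr fun r hr => hw r (by rwa [uIcc_of_le hs] at hr)
  have e3 : ∫ r in (0 : ℝ)..s, w r * invSq x (X r) = ∫ r in (0 : ℝ)..s, v (X r) * invSq x (X r) :=
    intervalIntegral.integral_congr fun r hr => by
      simp only [hw r (by rwa [uIcc_of_le hs] at hr)]
  have e4 : Q ((1 + b) ^ 2) x = invSq x 0 - invSq b 0 := by simp [Q, invSq]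
  rw [e1, e4, avg, e2, e3]
  constructor <;> intro h <;> linarith

/-- The kernel is positive, so `Q` is nonnegative along a solution, which means `(1 + x)² ≤ (1 +
b)²`. -/
lemma IsSolution.le {b T : ℝ} {x : ℝ → ℝ} (hb : 0 < b) (h : IsSolution ((1 + b) ^ 2) T x) {s : ℝ}
    (hs : s ∈ Icc 0 T) : x s ≤ b := by
  have h0 := h.2.1 s hs
  have hK : 0 ≤ ∫ r in (0 : ℝ)..s, K (x s) (x r) :=
    intervalIntegral.integral_nonneg hs.1 fun r hr => by
      have := h.2.1 r ⟨hr.1, hr.2.trans hs.2⟩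
      unfold K; positivity
  rw [← h.2.2 s hs, Q, sub_nonneg, one_div_le_one_div (by positivity) (by positivity)] at hK
  have := (pow_le_pow_iff_left₀ (by positivity) (by positivity) two_ne_zero).1 hK
  linarith

/-- The equilibrium equation has a unique maximal solution, up to the point `Z` where the integral
of `v` along the solution reaches `1`. -/
theorem exists_solution {b : ℝ} (hb : 0 < b) :
    ∃ (x : ℝ → ℝ) (Z : ℝ), 0 < Z ∧ Continuous x ∧ (∀ s, 0 < x s) ∧ (∀ s, x s ≤ b) ∧
      (∃ C, ∀ s s', |x s - x s'| ≤ C * |s - s'|) ∧ ∫ s in (0 : ℝ)..Z, v (x s) = 1 ∧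
      IsSolution ((1 + b) ^ 2) Z x ∧
      ∀ T x', IsSolution ((1 + b) ^ 2) T x' → ∫ s in (0 : ℝ)..T, v (x' s) ≤ 1 →
        EqOn x' x (Icc 0 T) := by
  obtain ⟨y, hy, ylip, yb, yproj, yeq⟩ := exists_timeChanged_solution hb
  obtain ⟨t₀, ht₀, hmin⟩ := isCompact_Icc.exists_isMinOn (nonempty_Icc.2 (zero_le_one (α := ℝ)))
    hy.continuousOn
  have hm : ∀ t, y t₀ ≤ y t := fun t => by
    rw [yproj t]; exact hmin (projIcc (0 : ℝ) 1 zero_le_one t).2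
  have hm0 : 0 < y t₀ := timeChanged_solution_pos hb hy yb yeq ht₀
  have ypos : ∀ t, 0 < y t := fun t => hm0.trans_le (hm t)
  set u : ℝ → ℝ := fun t => (v (y t))⁻¹ with hu
  have vc : Continuous fun t => v (y t) := continuousOn_v.comp_continuous hy ypos
  have vp : ∀ t, 0 < v (y t) := fun t => v_pos (ypos t)
  have uc : Continuous u := vc.inv₀ fun t => (vp t).ne'
  have up : ∀ t, 0 < u t := fun t => inv_pos.2 (vp t)
  -- Bound `1 / v(y) = 2y² / ((1 + y)(1 + 2y))` below, with the minimum of `y` in the numerator and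
  -- its upper bound `b` in the denominator.
  obtain ⟨c, hc, hcu⟩ : ∃ c, 0 < c ∧ ∀ t, c ≤ u t := by
    refine ⟨2 * y t₀ ^ 2 / ((1 + b) * (1 + 2 * b)), by positivity, fun t => ?_⟩
    have h1 := hm t
    have h2 := (yb t).2
    have h3 := ypos t
    simp only [hu, v, inv_div]
    gcongr
  set z : ℝ → ℝ := fun t => ∫ r in (0 : ℝ)..t, u r with hz
  have zd : ∀ t, HasDerivAt z (u t) t := fun t => (uc.integral_hasStrictDerivAt 0 t).hasDerivAt
  have zc : Continuous z := continuous_iff_continuousAt.2 fun t => (zd t).continuousAt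
  have zlow : ∀ t t', t ≤ t' → c * (t' - t) ≤ z t' - z t := fun t t' htt => by
    have e : z t' - z t = ∫ r in t..t', u r :=
      intervalIntegral.integral_interval_sub_left (uc.intervalIntegrable _ _)
        (uc.intervalIntegrable _ _)
    have := intervalIntegral.integral_mono_on (f := fun _ => c) (μ := volume) htt
      (continuous_const.intervalIntegrable _ _)
      (uc.intervalIntegrable t t') fun r _ => hcu r
    rw [intervalIntegral.integral_const, smul_eq_mul] at this
    linarith
  have z0 : z 0 = 0 := by simp [hz]
  have zmono : StrictMono z := fun t t' h => by
    have := zlow t t' h.le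
    have := mul_pos hc (sub_pos.2 h)
    linarith
  have zsurj : Function.Surjective z := by
    refine zc.surjective ?_ ?_
    · refine Filter.tendsto_atTop_mono' _ ?_ (Filter.Tendsto.const_mul_atTop hc Filter.tendsto_id)
      filter_upwards [Filter.eventually_ge_atTop 0] with t ht
      have := zlow 0 t ht
      simpa [z0] using this
    · refine Filter.tendsto_atBot_mono' _ ?_ (Filter.Tendsto.const_mul_atBot hc Filter.tendsto_id)
      filter_upwards [Filter.eventually_le_atBot 0] with t ht
      have := zlow t 0 ht
      simp only [z0] at this
      simp only [id]
      linarith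
  -- As `y` is constant outside `[0, 1]`, `z` is a bijection of the whole line. Its inverse `τ`
  -- turns the density `1` into `v (y (τ s))`, so `y ∘ τ` is the solution and `Z = z 1`.
  set e := zmono.orderIsoOfSurjective z zsurj with he
  set τ : ℝ → ℝ := fun s => e.symm s with hτ
  have zτ : ∀ s, z (τ s) = s := fun s => e.apply_symm_apply s
  have τz : ∀ t, τ (z t) = t := fun t => e.symm_apply_apply t
  have τc : Continuous τ := e.symm.continuous
  have τd : ∀ s, HasDerivAt τ (v (y (τ s))) s := fun s => by
    have := HasDerivAt.of_local_left_inverse τc.continuousAt (zd (τ s)) (up _).ne'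
      (Filter.Eventually.of_forall zτ)
    simpa [hu] using this
  have τ0 : τ 0 = 0 := by rw [← z0, τz, z0]
  have τmono : StrictMono τ := e.symm.strictMono
  have Zpos : 0 < z 1 := by rw [← z0]; exact zmono one_pos
  have subst : ∀ (F : ℝ → ℝ) (s : ℝ), Continuous F →
      ∫ r in (0 : ℝ)..s, v (y (τ r)) * F (τ r) = ∫ r in (0 : ℝ)..τ s, F r := fun F s hF => by
    have := intervalIntegral.integral_comp_mul_deriv (a := 0) (b := s) (f := τ) (g := F)
      (fun r _ => τd r) (vc.comp τc).continuousOn hF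
    rw [τ0] at this
    rw [← this]
    simp only [Function.comp, mul_comm]
  have mass : ∀ s, ∫ r in (0 : ℝ)..s, v (y (τ r)) = τ s := fun s => by
    have := subst (fun _ => 1) s continuous_const
    simpa using this
  refine ⟨fun s => y (τ s), z 1, Zpos, hy.comp τc, fun s => ypos _, fun s => (yb _).2,
    ⟨(slope b)⁻¹ * c⁻¹, fun s s' => ?_⟩, ?_, ⟨(hy.comp τc).continuousOn, fun s _ => ypos _,
      fun s hs => ?_⟩, fun T x' hx' hT => ?_⟩
  · have hlip : |τ s - τ s'| ≤ c⁻¹ * |s - s'| := by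
      rw [inv_mul_eq_div, le_div_iff₀ hc, mul_comm]
      rcases le_total s s' with h | h
      · have := zlow _ _ (τmono.monotone h)
        rw [zτ, zτ] at this
        rwa [abs_sub_comm, abs_of_nonneg (sub_nonneg.2 (τmono.monotone h)), abs_sub_comm,
          abs_of_nonneg (sub_nonneg.2 h)]
      · have := zlow _ _ (τmono.monotone h)
        rw [zτ, zτ] at this
        rwa [abs_of_nonneg (sub_nonneg.2 (τmono.monotone h)), abs_of_nonneg (sub_nonneg.2 h)]
    refine (ylip _ _).trans ?_
    rw [mul_assoc]
    exact mul_le_mul_of_nonneg_left hlip (inv_nonneg.2 (slope_pos hb).le)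
  · rw [mass, τz]
  · refine (Q_eq_integral_iff (X := fun s => y (τ s)) (w := fun r => v (y (τ r))) (ypos _).le hs.1
      (hy.comp τc).continuousOn (fun r _ => ypos _) fun r _ => rfl).2 ?_
    have hτs : τ s ∈ Icc (0 : ℝ) 1 :=
      ⟨by rw [← τ0]; exact τmono.monotone hs.1,
        by rw [← τz 1]; exact τmono.monotone hs.2⟩
    rw [← yeq _ hτs, avg, avg, mass,
      subst (fun r => invSq (y (τ s)) (y r)) s
        ((continuousOn_invSq (yb _).1).comp_continuous hy yb)]
    simp
  · intro s hs
    have hT0 : 0 ≤ T := hs.1.trans hs.2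
    set X : ℝ → ℝ := fun r => x' (projIcc 0 T hT0 r) with hX
    have Xc : Continuous X := hx'.1.comp_continuous (by fun_prop) fun r => (projIcc 0 T hT0 r).2
    have Xp : ∀ r, 0 < X r := fun r => hx'.2.1 _ (projIcc 0 T hT0 r).2
    have Xb : ∀ r, X r ≤ b := fun r => hx'.le hb (projIcc 0 T hT0 r).2
    have Xe : ∀ r ∈ Icc 0 T, X r = x' r := fun r hr => by simp only [hX, projIcc_of_mem _ hr]
    set w : ℝ → ℝ := fun r => v (X r) with hw
    have wc : Continuous w := continuousOn_v.comp_continuous Xc Xp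
    have wp : ∀ r, 0 < w r := fun r => v_pos (Xp r)
    set M : ℝ → ℝ := fun s => ∫ r in (0 : ℝ)..s, w r with hM
    have Md : ∀ s, HasDerivAt M (w s) s := fun s => (wc.integral_hasStrictDerivAt 0 s).hasDerivAt
    have M0 : M 0 = 0 := by simp [hM]
    have Mmono : StrictMono M := strictMono_of_hasDerivAt_pos Md wp
    have MT : M T ≤ 1 := by
      refine le_trans (le_of_eq ?_) hT
      refine intervalIntegral.integral_congr fun r hr => ?_
      rw [uIcc_of_le hT0] at hr
      simp only [hw, Xe r hr]
    have M1 : ∀ r ∈ Icc 0 T, M r ∈ Icc (0 : ℝ) 1 := fun r hr =>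
      ⟨by rw [← M0]; exact Mmono.monotone hr.1, (Mmono.monotone hr.2).trans MT⟩
    have Mc : Continuous M := continuous_iff_continuousAt.2 fun t => (Md t).continuousAt
    have substM : ∀ (F : ℝ → ℝ) (s : ℝ), Continuous F →
        ∫ r in (0 : ℝ)..s, w r * F (M r) = ∫ r in (0 : ℝ)..M s, F r := fun F s hF => by
      have := intervalIntegral.integral_comp_mul_deriv (a := 0) (b := s) (f := M) (g := F)
        (fun r _ => Md r) wc.continuousOn hF
      rw [M0] at this
      rw [← this]
      simp only [Function.comp, mul_comm]
    -- For the density `w` of the competing solution, both `X` and `y ∘ M` satisfy the first order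
    -- condition, so Gronwall identifies them. It remains to see that `M` is the time change `τ`.
    have eqXY : EqOn X (fun r => y (M r)) (Icc 0 T) := by
      refine root_unique hb wc (fun r => (wp r).le) Xc (fun r => ⟨(Xp r).le, Xb r⟩)
        (hy.comp Mc) (fun r => yb _) (fun r hr => (M1 r hr).2) (fun r hr => ?_) fun r hr => ?_
      · rw [← Q_eq_integral_iff (Xp r).le hr.1 Xc.continuousOn (fun r _ => Xp r) fun r _ => rfl,
          Xe r hr, hx'.2.2 r hr]
        refine intervalIntegral.integral_congr fun q hq => ?_
        rw [uIcc_of_le hr.1] at hq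
        simp only [Xe q ⟨hq.1, hq.2.trans hr.2⟩]
      · rw [← yeq _ (M1 r hr), avg, avg,
          substM (fun q => invSq (y (M r)) (y q)) r
            ((continuousOn_invSq (yb _).1).comp_continuous hy yb)]
        simp [hM]
    have zM : z (M s) = s := by
      simp only [hz]
      rw [← substM u s uc]
      have : ∫ r in (0 : ℝ)..s, w r * u (M r) = ∫ r in (0 : ℝ)..s, (1 : ℝ) := by
        refine intervalIntegral.integral_congr fun r hr => ?_
        rw [uIcc_of_le hs.1] at hr
        have h1 := eqXY ⟨hr.1, hr.2.trans hs.2⟩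
        simp only [hw, hu, ← h1]
        exact mul_inv_cancel₀ (v_pos (Xp r)).ne'
      rw [this]; simp
    have : τ s = M s := by rw [← zM, τz, zM]
    simp only [← Xe s hs, eqXY hs, this]

/-! ### Optimality of a curve, and its equivalence with the equilibrium equation. -/

/-- Relative revenue from selling `x` after the amount `a` has been sold. -/
noncomputable def revenue (x a : ℝ) : ℝ := x / ((1 + a) * (1 + a + x))

/-- Normalized payoff of the trading amount `x` at the gas fee at distance `s` below the highest
one, against an opponent who trades `X r` at distance `r` with density `w`. -/
noncomputable def gain (b : ℝ) (w X : ℝ → ℝ) (x s : ℝ) : ℝ :=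
  s - x * invSq b 0 + avg w X s (revenue x)

lemma continuousOn_revenue {b x : ℝ} (hx : 0 ≤ x) : ContinuousOn (revenue x) (Icc 0 b) := by
  unfold revenue
  refine ContinuousOn.div (by fun_prop) (by fun_prop) fun a ha => ?_
  have := ha.1
  positivity

/-- The normalized first-mover advantage between two equal amounts is `1 / v`; this is how `v`
becomes the equilibrium density. -/
lemma revenue_sub_eq {a : ℝ} (ha : 0 < a) : revenue a 0 - revenue a a = (v a)⁻¹ := by
  unfold revenue v
  have h1 : 1 + a ≠ 0 := by positivity
  have h2 : 1 + a + a ≠ 0 := by positivity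
  have h3 : 1 + 2 * a ≠ 0 := by positivity
  field_simp
  ring

/-- Strong concavity of revenue in the amount, with `invSq r a` as the slope at `r`: the gap below
the tangent is exactly `(x - r)² / ((1 + a + x)(1 + a + r)²)`. -/
lemma revenue_le {b x r a : ℝ} (hx : x ∈ Icc 0 b) (hr : r ∈ Icc 0 b) (ha : a ∈ Icc 0 b) :
    (1 / (1 + 2 * b)) ^ 3 * (x - r) ^ 2 + (r - x) * invSq r a ≤ revenue r a - revenue x a := by
  obtain ⟨hx0, hxb⟩ := hx
  obtain ⟨hr0, hrb⟩ := hr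
  obtain ⟨ha0, hab⟩ := ha
  have hb : 0 ≤ b := ha0.trans hab
  have h1 : 0 < 1 + a := by positivity
  have h2 : 0 < 1 + a + x := by positivity
  have h3 : 0 < 1 + a + r := by positivity
  have e : revenue r a - revenue x a - (r - x) * invSq r a =
      (1 / (1 + a + x) * (1 / (1 + a + r)) * (1 / (1 + a + r))) * (x - r) ^ 2 := by
    unfold revenue invSq
    field_simp
    ring
  have hk : 0 < 1 / (1 + 2 * b) := by positivity
  have h4 : 1 / (1 + 2 * b) ≤ 1 / (1 + a + x) := one_div_le_one_div_of_le h2 (by linarith)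
  have h5 : 1 / (1 + 2 * b) ≤ 1 / (1 + a + r) := one_div_le_one_div_of_le h3 (by linarith)
  have h6 : (1 / (1 + 2 * b)) ^ 3 ≤ 1 / (1 + a + x) * (1 / (1 + a + r)) * (1 / (1 + a + r)) := by
    rw [pow_succ, pow_two]
    gcongr
  have := mul_le_mul_of_nonneg_right h6 (sq_nonneg (x - r))
  linarith

section

variable {w X : ℝ → ℝ} {s b : ℝ}

lemma avg_const_mul (c : ℝ) (F : ℝ → ℝ) : avg w X s (fun a => c * F a) = c * avg w X s F := by
  simp only [avg, mul_left_comm _ c, intervalIntegral.integral_const_mul]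
  ring

/-- Averaging the tangent inequality, the linear term cancels against the cost by the first order
condition at `r`. So a root is the global maximum, with a quadratic margin that makes it the only
one. -/
lemma gain_le (hw : Continuous w) (hw0 : ∀ r, 0 ≤ w r) (hX : Continuous X)
    (hXb : ∀ r, X r ∈ Icc 0 b) (hs : 0 ≤ s) (hM : ∫ r in (0 : ℝ)..s, w r ≤ 1) {x r : ℝ}
    (hx : x ∈ Icc 0 b) (hr : r ∈ Icc 0 b) (e : avg w X s (invSq r) = invSq b 0) :
    (1 / (1 + 2 * b)) ^ 3 * (x - r) ^ 2 ≤ gain b w X r s - gain b w X x s := by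
  have c1 := continuousOn_revenue (b := b) hr.1
  have c2 := continuousOn_revenue (b := b) hx.1
  have c3 : ContinuousOn (fun a => (r - x) * invSq r a) (Icc 0 b) :=
    continuousOn_const.mul (continuousOn_invSq hr.1)
  have c4 : ContinuousOn (fun a => revenue r a - revenue x a) (Icc 0 b) := c1.sub c2
  have h := avg_mono hw hw0 hX hXb hs hM (F := fun _ => (1 / (1 + 2 * b)) ^ 3 * (x - r) ^ 2)
    (G := fun a => revenue r a - revenue x a - (r - x) * invSq r a)
    continuousOn_const (c4.sub c3) fun a ha => by
      have := revenue_le hx hr ha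
      linarith
  rw [avg_const, ← avg_sub hw hX hXb c4 c3,
    ← avg_sub hw hX hXb c1 c2, avg_const_mul, e] at h
  unfold gain
  linarith

lemma root_of_isMax (hb : 0 < b) (hw : Continuous w) (hw0 : ∀ r, 0 ≤ w r) (hX : Continuous X)
    (hXb : ∀ r, X r ∈ Icc 0 b) (hs : 0 ≤ s) (hM : ∫ r in (0 : ℝ)..s, w r ≤ 1) {x : ℝ}
    (hx : x ∈ Icc 0 b) (h : ∀ x' ∈ Icc 0 b, gain b w X x' s ≤ gain b w X x s) :
    avg w X s (invSq x) = invSq b 0 := by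
  obtain ⟨r, hr, e⟩ := exists_root hw hw0 hX hXb hs hM
  have h1 := gain_le hw hw0 hX hXb hs hM hx hr e
  have h2 := h r hr
  have h3 : (0 : ℝ) < (1 / (1 + 2 * b)) ^ 3 := by positivity
  have h4 : (x - r) ^ 2 = 0 :=
    le_antisymm (nonpos_of_mul_nonpos_right (by linarith) h3) (sq_nonneg _)
  rw [sub_eq_zero.1 (pow_eq_zero_iff two_ne_zero |>.1 h4), e]

lemma hasDerivAt_gain (hw : Continuous w) (hX : Continuous X) (hXb : ∀ r, X r ∈ Icc 0 b) {x : ℝ}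
    (hx : 0 ≤ x) (s : ℝ) :
    HasDerivAt (gain b w X x) (1 - w s * (revenue x 0 - revenue x (X s))) s := by
  have h1 := (hw.integral_hasStrictDerivAt 0 s).hasDerivAt
  have h2 := ((continuous_weighted hw hX hXb (continuousOn_revenue hx)).integral_hasStrictDerivAt
    0 s).hasDerivAt
  have := ((hasDerivAt_id s).sub_const (x * invSq b 0)).add
    (((h1.const_sub 1).mul_const (revenue x 0)).add h2)
  exact this.congr_deriv (by ring)

lemma continuous_gain (hw : Continuous w) (hX : Continuous X) (hXb : ∀ r, X r ∈ Icc 0 b)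
    {ι : Type*} [TopologicalSpace ι] [FirstCountableTopology ι] [LocallyCompactSpace ι]
    {x σ : ι → ℝ} (hx : Continuous x)
    (hx0 : ∀ i, 0 ≤ x i) (hσ : Continuous σ) : Continuous fun i => gain b w X (x i) (σ i) := by
  have hM : Continuous fun s => ∫ r in (0 : ℝ)..s, w r :=
    continuous_iff_continuousAt.2 fun s =>
      (hw.integral_hasStrictDerivAt 0 s).hasDerivAt.continuousAt
  have h1 : Continuous fun i => revenue (x i) 0 := by
    unfold revenue
    refine Continuous.div (by fun_prop) (by fun_prop) fun i => ?_
    have := hx0 i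
    positivity
  have h2 : Continuous fun i => ∫ r in (0 : ℝ)..σ i, w r * revenue (x i) (X r) := by
    refine continuous_parametric_intervalIntegral_of_continuous ?_ hσ
    unfold revenue Function.uncurry
    refine Continuous.mul (by fun_prop) (Continuous.div (by fun_prop) (by fun_prop) fun i => ?_)
    have := hx0 i.1
    have := (hXb i.2).1
    positivity
  unfold gain avg
  exact (hσ.sub (hx.mul continuous_const)).add
    (((continuous_const.sub (hM.comp hσ)).mul h1).add h2)

/-- Indifference along the curve determines the density. -/
lemma density_mul_eq_one {T : ℝ} (hT : 0 < T) (hw : Continuous w) (hX : Continuous X)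
    (hXb : ∀ r, X r ∈ Icc 0 b)
    (h : ∀ s ∈ Icc 0 T, ∀ s' ∈ Icc 0 T, gain b w X (X s) s' ≤ gain b w X (X s) s) :
    ∀ s ∈ Icc 0 T, w s * (revenue (X s) 0 - revenue (X s) (X s)) = 1 := by
  have h1 : EqOn (fun s => w s * (revenue (X s) 0 - revenue (X s) (X s))) (fun _ => 1)
      (Ioo 0 T) := fun s hs => by
    -- The amount `X s` stays fixed while the fee varies, so no differentiability of `X` is needed.
    have hmax : IsLocalMax (gain b w X (X s)) s := by
      filter_upwards [Icc_mem_nhds hs.1 hs.2] with s' hs'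
      exact h s (Ioo_subset_Icc_self hs) s' hs'
    have := hmax.hasDerivAt_eq_zero (hasDerivAt_gain hw hX hXb (hXb s).1 s)
    simp only
    linarith
  have h2 : Continuous fun s => w s * (revenue (X s) 0 - revenue (X s) (X s)) := by
    unfold revenue
    refine hw.mul (Continuous.sub (Continuous.div hX (by fun_prop) fun s => ?_)
      (Continuous.div hX (by fun_prop) fun s => ?_)) <;>
    · have := (hXb s).1
      positivity
  have := h1.closure h2 continuous_const
  rwa [closure_Ioo hT.ne] at this

/-- Optimality of the curve `X` with density `w` implies the equilibrium equation. -/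
lemma isSolution_of_isMax {T : ℝ} (hb : 0 < b) (hT : 0 < T) (hw : Continuous w)
    (hw0 : ∀ r, 0 ≤ w r) (hX : Continuous X) (hXb : ∀ r, X r ∈ Icc 0 b)
    (hM : ∫ r in (0 : ℝ)..T, w r ≤ 1)
    (h : ∀ s ∈ Icc 0 T, ∀ s' ∈ Icc 0 T, ∀ x ∈ Icc 0 b,
      gain b w X x s' ≤ gain b w X (X s) s) :
    IsSolution ((1 + b) ^ 2) T X ∧ ∀ s ∈ Icc 0 T, w s = v (X s) := by
  have hd := density_mul_eq_one hT hw hX hXb fun s hs s' hs' => h s hs s' hs' _ (hXb s)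
  -- A zero amount earns no revenue in either order, which contradicts the indifference identity.
  have hpos : ∀ s ∈ Icc 0 T, 0 < X s := fun s hs => by
    refine (hXb s).1.lt_of_ne' fun h0 => ?_
    have := hd s hs
    simp [h0, revenue] at this
  have hwv : ∀ s ∈ Icc 0 T, w s = v (X s) := fun s hs => by
    have := hd s hs
    rw [revenue_sub_eq (hpos s hs), mul_inv_eq_one₀ (v_pos (hpos s hs)).ne'] at this
    exact this
  refine ⟨⟨hX.continuousOn, hpos, fun s hs => ?_⟩, hwv⟩
  have sub : Icc 0 s ⊆ Icc 0 T := Icc_subset_Icc_right hs.2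
  rw [Q_eq_integral_iff (w := w) (hXb s).1 hs.1 hX.continuousOn (fun r hr => hpos r (sub hr))
    fun r hr => hwv r (sub hr)]
  refine root_of_isMax hb hw hw0 hX hXb hs.1 ?_ (hXb s) fun x hx => h s hs s hs x hx
  refine le_trans ?_ hM
  exact intervalIntegral.integral_mono_interval le_rfl hs.1 hs.2
    (Filter.Eventually.of_forall hw0) (hw.intervalIntegrable _ _)

end

/-- The value of being first changes slowly with one's own amount; this bounds the fee derivative of
`gain` slightly off the curve. -/
lemma revenue_sub_bound {x a : ℝ} (hx : 0 ≤ x) (ha : 0 ≤ a) :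
    |revenue a a - revenue x a - (revenue a 0 - revenue x 0)| ≤ |a - x| := by
  have h1 : 0 < 1 + a := by positivity
  have h2 : 0 < 1 + a + x := by positivity
  have h3 : 0 < 1 + a + a := by positivity
  have h4 : 0 < 1 + x := by positivity
  have e : revenue a a - revenue x a - (revenue a 0 - revenue x 0) =
      (a - x) * (1 / (1 + a + a) * (1 / (1 + a + x)) - 1 / (1 + a) * (1 / (1 + x))) := by
    unfold revenue
    field_simp
    ring
  have b1 : ∀ c : ℝ, 1 ≤ c → 1 / c ∈ Icc (0 : ℝ) 1 := fun c hc =>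
    ⟨by positivity, (div_le_one (by positivity)).2 hc⟩
  have p1 := b1 (1 + a + a) (by linarith)
  have p2 := b1 (1 + a + x) (by linarith)
  have p3 := b1 (1 + a) (by linarith)
  have p4 := b1 (1 + x) (by linarith)
  have q1 := mul_nonneg p1.1 p2.1
  have q2 := mul_nonneg p3.1 p4.1
  have q3 := mul_le_one₀ p1.2 p2.1 p2.2
  have q4 := mul_le_one₀ p3.2 p4.1 p4.2
  rw [e, abs_mul]
  refine mul_le_of_le_one_right (abs_nonneg _) (abs_le.2 ⟨by linarith, by linarith⟩)

/-- A function whose increments are bounded by their squares is constant. -/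
lemma eq_of_abs_sub_le_sq {h : ℝ → ℝ} {C T : ℝ} (hc : ContinuousOn h (Icc 0 T))
    (hq : ∀ s ∈ Icc 0 T, ∀ s' ∈ Icc 0 T, |h s' - h s| ≤ C * (s' - s) ^ 2) :
    ∀ s ∈ Icc 0 T, h s = h 0 := by
  -- A quadratic bound on increments forces the right derivative to be zero.
  refine constant_of_has_deriv_right_zero hc fun s hs => ?_
  have : HasFDerivWithinAt (fun s' => h s' - h s) (0 : ℝ →L[ℝ] ℝ) (Ici s) s := by
    refine Asymptotics.IsBigO.hasFDerivWithinAt (n := 2) ?_ self_mem_Ici one_lt_two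
    refine Asymptotics.IsBigO.of_bound C ?_
    have : Icc s T ∈ nhdsWithin s (Ici s) := Icc_mem_nhdsGE hs.2
    filter_upwards [this] with s' hs'
    have := hq s (Ico_subset_Icc_self hs) s' ⟨hs.1.trans hs'.1, hs'.2⟩
    simpa using this
  have h2 := this.hasDerivWithinAt.add_const (h s)
  simpa using h2

/-- Along the solution of the equilibrium equation the payoff is constant. -/
lemma gain_eq_of_isSolution {b Z C : ℝ} {x : ℝ → ℝ} (hb : 0 < b) (hx : Continuous x)
    (hx0 : ∀ s, 0 < x s) (hxb : ∀ s, x s ≤ b) (hlip : ∀ s s', |x s - x s'| ≤ C * |s - s'|)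
    (hZ : ∫ s in (0 : ℝ)..Z, v (x s) ≤ 1) (sol : IsSolution ((1 + b) ^ 2) Z x) :
    ∀ s ∈ Icc 0 Z, (∀ x' ∈ Icc 0 b, gain b (fun r => v (x r)) x x' s ≤ b ^ 2 / (1 + b) ^ 2) ∧
      gain b (fun r => v (x r)) x (x s) s = b ^ 2 / (1 + b) ^ 2 := by
  set w : ℝ → ℝ := fun r => v (x r) with hw
  have wc : Continuous w := continuousOn_v.comp_continuous hx hx0
  have w0 : ∀ r, 0 < w r := fun r => v_pos (hx0 r)
  have xI : ∀ r, x r ∈ Icc 0 b := fun r => ⟨(hx0 r).le, hxb r⟩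
  have hM : ∀ s ∈ Icc 0 Z, ∫ r in (0 : ℝ)..s, w r ≤ 1 := fun s hs =>
    (intervalIntegral.integral_mono_interval le_rfl hs.1 hs.2
      (Filter.Eventually.of_forall fun r => (w0 r).le) (wc.intervalIntegrable _ _)).trans hZ
  have heq : ∀ s ∈ Icc 0 Z, avg w x s (invSq (x s)) = invSq b 0 := fun s hs =>
    (Q_eq_integral_iff (hx0 s).le hs.1 hx.continuousOn (fun r _ => hx0 r) fun r _ => rfl).1
      (sol.2.2 s hs)
  have hle : ∀ s ∈ Icc 0 Z, ∀ x' ∈ Icc 0 b, gain b w x x' s ≤ gain b w x (x s) s :=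
    fun s hs x' hx' => by
      have := gain_le wc (fun r => (w0 r).le) hx xI hs.1 (hM s hs) hx' (xI s) (heq s hs)
      have : 0 ≤ (1 / (1 + 2 * b)) ^ 3 * (x' - x s) ^ 2 := by positivity
      linarith
  obtain ⟨B, hB⟩ := isCompact_Icc.exists_bound_of_continuousOn (s := Icc 0 Z) wc.continuousOn
  -- At the fixed amount `x s` the fee derivative vanishes at `s` and is `O(|s' - s|)` nearby,
  -- because `x` is Lipschitz.
  have quad : ∀ s ∈ Icc 0 Z, ∀ s' ∈ Icc 0 Z,
      |gain b w x (x s) s' - gain b w x (x s) s| ≤ B * C * |s' - s| * |s' - s| := by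
    intro s hs s' hs'
    have e : gain b w x (x s) s' - gain b w x (x s) s =
        ∫ r in s..s', (1 - w r * (revenue (x s) 0 - revenue (x s) (x r))) :=
      (intervalIntegral.integral_eq_sub_of_hasDerivAt
        (fun r _ => hasDerivAt_gain wc hx xI (hx0 s).le r)
        (Continuous.intervalIntegrable (continuous_const.sub (wc.mul (continuous_const.sub
          ((continuousOn_revenue (hx0 s).le).comp_continuous hx xI)))) _ _)).symm
    rw [e, ← Real.norm_eq_abs]
    refine intervalIntegral.norm_integral_le_of_norm_le_const fun r hr => ?_
    have hr' : r ∈ Icc 0 Z := by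
      have := uIoc_subset_uIcc hr
      exact (uIcc_subset_Icc hs hs') this
    have hrs : |r - s| ≤ |s' - s| := by
      rw [abs_sub_comm r, abs_sub_comm s']
      have := abs_sub_left_of_mem_uIcc (uIoc_subset_uIcc hr)
      rwa [abs_sub_comm r, abs_sub_comm s'] at this
    have e1 : 1 - w r * (revenue (x s) 0 - revenue (x s) (x r)) =
        -(w r * (revenue (x r) (x r) - revenue (x s) (x r) -
          (revenue (x r) 0 - revenue (x s) 0))) := by
      have := revenue_sub_eq (hx0 r)
      have h1 : w r * (revenue (x r) 0 - revenue (x r) (x r)) = 1 := by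
        rw [this]; exact mul_inv_cancel₀ (w0 r).ne'
      linarith
    have hC : |x r - x s| ≤ C * |s' - s| := by
      refine (hlip r s).trans ?_
      -- The sign of `C` is not given; it must be read off from the Lipschitz bound at two distinct
      -- points.
      rcases eq_or_ne r s with rfl | hne
      · simp only [sub_self, abs_zero, mul_zero]
        rcases eq_or_ne s' r with rfl | hne'
        · simp
        · have h1 := (abs_nonneg _).trans (hlip s' r)
          exact h1
      · have h1 := (abs_nonneg _).trans (hlip r s)
        have : 0 ≤ C := nonneg_of_mul_nonneg_left h1 (abs_pos.2 (sub_ne_zero.2 hne))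
        gcongr
    have hB0 := hB r hr'
    rw [e1, norm_neg, norm_mul, mul_assoc B]
    refine mul_le_mul hB0 ?_ (norm_nonneg _) ((norm_nonneg _).trans hB0)
    exact (revenue_sub_bound (hx0 s).le (hx0 r).le).trans hC
  -- Envelope argument: as each amount is optimal at its own fee, the increment along the curve lies
  -- between two increments at fixed amount, both quadratically small.
  have hconst := eq_of_abs_sub_le_sq (h := fun s => gain b w x (x s) s) (C := B * C) (T := Z)
    (continuous_gain wc hx xI hx (fun s => (hx0 s).le) continuous_id).continuousOn
    (fun s hs s' hs' => by
      have h1 := quad s hs s' hs'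
      have h2 := quad s' hs' s hs
      have h3 := hle s' hs' _ (xI s)
      have h4 := hle s hs _ (xI s')
      rw [abs_sub_comm s s', mul_assoc, abs_mul_abs_self, ← pow_two] at h2
      rw [mul_assoc, abs_mul_abs_self, ← pow_two] at h1
      rw [abs_le] at h1 h2 ⊢
      constructor <;> linarith [h1.1, h1.2, h2.1, h2.2])
  have hval : ∀ s ∈ Icc 0 Z, gain b w x (x s) s = b ^ 2 / (1 + b) ^ 2 := fun s hs => by
    have h0 := heq 0 ⟨le_rfl, hs.1.trans hs.2⟩
    -- Nobody bids above the top fee, so the amount there is that of a sure first mover.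
    have hx0b : x 0 = b := by
      have h1 := hx0 0
      simp only [avg, integral_same, sub_zero, one_mul, add_zero, invSq] at h0
      have := (one_div_le_one_div (by positivity) (by positivity)).1 h0.ge
      have := (pow_le_pow_iff_left₀ (by positivity) (by positivity) two_ne_zero).1 this
      have := (one_div_le_one_div (by positivity) (by positivity)).1 h0.le
      have := (pow_le_pow_iff_left₀ (by positivity) (by positivity) two_ne_zero).1 this
      linarith
    have h1 := hconst s hs
    rw [h1, hx0b]
    simp only [gain, avg, integral_same, invSq, revenue]
    field_simp
    ring
  exact fun s hs => ⟨fun x' hx' => (hle s hs x' hx').trans (hval s hs).le, hval s hs⟩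

/-! ### Normalization of the pool, and Nash equilibrium in terms of single actions. -/

namespace Pool

/-- `P` is a pool in which the size of the arbitrage opportunity is `(1 + b) ^ 2`. -/
structure HasSize (P : Pool) (b : ℝ) : Prop where
  yA_pos : 0 < P.yA
  LB_pos : 0 < P.LB
  b_pos : 0 < b
  cost_eq : (1 + P.f) * P.pA * P.yA = P.LB * invSq b 0
  DHat_eq : P.DHat = P.yA * b
  gHat_eq : P.gHat = P.LB * (b ^ 2 / (1 + b) ^ 2)

lemma hasSize {P : Pool} (hyA : 0 < P.yA) (hyB : 0 < P.yB) (hpA : 0 < P.pA) (hpB : 0 < P.pB)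
    (hf : 0 ≤ P.f) (hO : 1 < P.opp) : P.HasSize (Real.sqrt P.opp - 1) where
  yA_pos := hyA
  LB_pos := mul_pos hyB hpB
  b_pos := by rw [sub_pos]; exact Real.lt_sqrt_of_sq_lt (by simpa using hO)
  cost_eq := by
    have h : (1 + 0 + (Real.sqrt P.opp - 1)) ^ 2 = P.opp := by
      rw [add_zero, add_sub_cancel, Real.sq_sqrt (by linarith)]
    rw [invSq, h]
    simp only [LB, opp]
    field_simp
  DHat_eq := by rw [DHat, mul_comm]
  gHat_eq := by
    have : 0 < Real.sqrt P.opp := Real.sqrt_pos.2 (by linarith)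
    rw [gHat, add_sub_cancel]
    field_simp

variable {P : Pool} {b : ℝ}

lemma HasSize.RF_eq (h : P.HasSize b) {x : ℝ} (hx : 0 ≤ x) (g : ℝ) :
    P.RF g (P.yA * x) = P.LB * (revenue x 0 - x * invSq b 0) - g := by
  have h1 := h.yA_pos
  have h2 : P.yA + P.yA * x ≠ 0 := by positivity
  have h3 : 1 + x ≠ 0 := by positivity
  have e1 : P.yA * x * (P.yB / (P.yA + P.yA * x) * P.pB) = P.LB * revenue x 0 := by
    unfold LB revenue
    field_simp
    simp only [add_zero]
    ring
  have e2 : P.yA * x * ((1 + P.f) * P.pA) = x * (P.LB * invSq b 0) := by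
    rw [← h.cost_eq]; ring
  rw [RF, mul_sub, e1, e2]
  ring

lemma HasSize.V_eq (h : P.HasSize b) {x a : ℝ} (hx : 0 ≤ x) (ha : 0 ≤ a) :
    P.V (P.yA * x) (P.yA * a) = P.LB * (revenue x 0 - revenue x a) := by
  have h1 := h.yA_pos
  have h2 : P.yA + P.yA * x ≠ 0 := by positivity
  have h3 : 1 + x ≠ 0 := by positivity
  have h4 : P.yA + P.yA * a ≠ 0 := by positivity
  have h5 : P.yA + P.yA * a + P.yA * x ≠ 0 := by positivity
  have h6 : 1 + a ≠ 0 := by positivity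
  have h7 : 1 + a + x ≠ 0 := by positivity
  unfold V LB revenue
  rw [show P.yA + P.yA * a + P.yA * x = P.yA * (1 + a + x) by ring,
    show P.yA + P.yA * x = P.yA * (1 + x) by ring, show P.yA + P.yA * a = P.yA * (1 + a) by ring]
  field_simp
  ring

lemma measurable_RF (P : Pool) : Measurable fun a : ℝ × ℝ => P.RF a.1 a.2 := by
  unfold RF
  fun_prop

lemma measurable_V (P : Pool) : Measurable fun q : ℝ × ℝ => P.V q.1 q.2 := by
  unfold V
  fun_prop

lemma measurable_contest (P : Pool) :
    Measurable fun q : (ℝ × ℝ) × (ℝ × ℝ) => P.contest q.1 q.2 := by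
  have h1 : Measurable fun q : (ℝ × ℝ) × (ℝ × ℝ) => P.RF q.1.1 q.1.2 :=
    P.measurable_RF.comp measurable_fst
  have h2 : Measurable fun q : (ℝ × ℝ) × (ℝ × ℝ) => P.V q.1.2 q.2.2 :=
    P.measurable_V.comp (f := fun q : (ℝ × ℝ) × (ℝ × ℝ) => (q.1.2, q.2.2)) (by fun_prop)
  unfold contest RS
  exact Measurable.ite (measurableSet_lt (by fun_prop) (by fun_prop)) h1
    (Measurable.ite (measurableSet_eq_fun (by fun_prop) (by fun_prop))
      ((h1.const_mul _).add ((h1.sub h2).const_mul _)) (h1.sub h2))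

/-- Uniform bounds on the compact action set supply the integrability needed for Fubini. -/
lemma HasSize.actions_bound (h : P.HasSize b) (gL : ℝ) :
    ∃ C, (∀ a ∈ P.actions gL, |P.RF a.1 a.2| ≤ C) ∧
      ∀ a ∈ P.actions gL, ∀ a' ∈ P.actions gL, |P.contest a a'| ≤ C := by
  have hy := h.yA_pos
  have hc : IsCompact (P.actions gL) := isCompact_Icc.prod isCompact_Icc
  have c1 : ContinuousOn (fun a : ℝ × ℝ => P.RF a.1 a.2) (P.actions gL) := by
    unfold RF
    refine ContinuousOn.sub (ContinuousOn.mul (by fun_prop) (ContinuousOn.sub (ContinuousOn.mul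
      (ContinuousOn.div (by fun_prop) (by fun_prop) fun a ha => ?_) (by fun_prop)) (by fun_prop)))
      (by fun_prop)
    have := ha.2.1
    positivity
  have c2 : ContinuousOn (fun q : (ℝ × ℝ) × (ℝ × ℝ) => P.V q.1.2 q.2.2)
      (P.actions gL ×ˢ P.actions gL) := by
    unfold V
    refine ContinuousOn.mul (ContinuousOn.mul (ContinuousOn.sub
      (ContinuousOn.div (by fun_prop) (by fun_prop) fun q hq => ?_)
      (ContinuousOn.div (by fun_prop) (by fun_prop) fun q hq => ?_)) (by fun_prop)) (by fun_prop)
    · have := hq.1.2.1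
      positivity
    · have := hq.1.2.1
      have := hq.2.2.1
      positivity
  obtain ⟨C₁, hC₁⟩ := hc.exists_bound_of_continuousOn c1
  obtain ⟨C₂, hC₂⟩ := (hc.prod hc).exists_bound_of_continuousOn c2
  refine ⟨C₁ + |C₂|, fun a ha => (hC₁ a ha).trans (by simp), fun a ha a' ha' => ?_⟩
  have h1 := hC₁ a ha
  have h2 := (hC₂ (a, a') ⟨ha, ha'⟩).trans (le_abs_self C₂)
  simp only [Real.norm_eq_abs, abs_le] at h1 h2
  unfold contest RS
  rw [abs_le]
  split_ifs <;> constructor <;> linarith [h1.1, h1.2, h2.1, h2.2, abs_nonneg C₂]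

/-- Expected payoff of trading with the action `a` against the strategy `(α, μ)`. -/
noncomputable def actionPayoff (P : Pool) (α : ℝ) (μ : Measure (ℝ × ℝ)) (a : ℝ × ℝ) : ℝ :=
  (1 - α) * P.RF a.1 a.2 + α * ∫ a', P.contest a a' ∂μ

section Fubini

variable {gL α β : ℝ} {μ ν : Measure (ℝ × ℝ)}

lemma HasSize.integrable_RF (h : P.HasSize b) (hν : P.IsMixed gL β ν) :
    Integrable (fun a => P.RF a.1 a.2) ν := by
  obtain ⟨C, hC, -⟩ := h.actions_bound gL
  have := hν.2.1
  refine Integrable.of_bound P.measurable_RF.aestronglyMeasurable C ?_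
  filter_upwards [compl_mem_ae_iff.2 hν.2.2] with a ha
  exact hC a (not_not.1 ha)

lemma HasSize.integrable_contest (h : P.HasSize b) (hν : P.IsMixed gL β ν)
    (hμ : P.IsMixed gL α μ) :
    Integrable (fun q : (ℝ × ℝ) × (ℝ × ℝ) => P.contest q.1 q.2) (ν.prod μ) := by
  obtain ⟨C, -, hC⟩ := h.actions_bound gL
  have := hν.2.1
  have := hμ.2.1
  refine Integrable.of_bound P.measurable_contest.aestronglyMeasurable C ?_
  have h1 : ∀ᵐ a ∂ν, a ∈ P.actions gL := by
    filter_upwards [compl_mem_ae_iff.2 hν.2.2] with a ha using not_not.1 ha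
  have h2 : ∀ᵐ a ∂μ, a ∈ P.actions gL := by
    filter_upwards [compl_mem_ae_iff.2 hμ.2.2] with a ha using not_not.1 ha
  filter_upwards [Measure.quasiMeasurePreserving_fst.ae h1,
    Measure.quasiMeasurePreserving_snd.ae h2] with q hq1 hq2
  exact hC _ hq1 _ hq2

lemma HasSize.integrable_actionPayoff (h : P.HasSize b) (hν : P.IsMixed gL β ν)
    (hμ : P.IsMixed gL α μ) : Integrable (P.actionPayoff α μ) ν := by
  have := hν.2.1
  have := hμ.2.1
  exact ((h.integrable_RF hν).const_mul _).add
    ((h.integrable_contest hν hμ).integral_prod_left.const_mul _)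

lemma HasSize.payoff_eq (h : P.HasSize b) (hν : P.IsMixed gL β ν) (hμ : P.IsMixed gL α μ) :
    P.payoff β ν α μ = β * ∫ a, P.actionPayoff α μ a ∂ν := by
  have := hν.2.1
  have := hμ.2.1
  unfold payoff actionPayoff
  rw [integral_prod _ (h.integrable_contest hν hμ),
    integral_add ((h.integrable_RF hν).const_mul _)
      ((h.integrable_contest hν hμ).integral_prod_left.const_mul _),
    MeasureTheory.integral_const_mul, MeasureTheory.integral_const_mul]
  ring

lemma isMixed_dirac {a : ℝ × ℝ} (ha : a ∈ P.actions gL) (hα : α ∈ Icc (0 : ℝ) 1) :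
    P.IsMixed gL α (Measure.dirac a) := by
  refine ⟨hα, inferInstance, ?_⟩
  have hm : MeasurableSet (P.actions gL) := measurableSet_Icc.prod measurableSet_Icc
  rw [Measure.dirac_apply' _ hm.compl]
  simpa using ha

/-- Nash equilibria in terms of the payoff of single actions. -/
lemma HasSize.isNash_iff (h : P.HasSize b) (hμ : P.IsMixed gL α μ) (hα : 0 < α) :
    P.IsNash gL α μ ↔
      (∀ a ∈ P.actions gL, P.actionPayoff α μ a ≤ ∫ a, P.actionPayoff α μ a ∂μ) ∧
        0 ≤ ∫ a, P.actionPayoff α μ a ∂μ ∧ (α < 1 → ∫ a, P.actionPayoff α μ a ∂μ = 0) := by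
  set C := ∫ a, P.actionPayoff α μ a ∂μ with hC
  constructor
  -- The payoff is `β` times an integral over actions. Deviating to `β = 0` gives nonnegativity,
  -- Dirac measures give optimality over single actions, and `β = 1` forces a zero value when `α <
  -- 1`.
  · rintro ⟨-, hN⟩
    have h0 : 0 ≤ C := by
      have := hN 0 μ ⟨⟨le_rfl, zero_le_one⟩, hμ.2⟩
      rw [h.payoff_eq ⟨⟨le_rfl, zero_le_one⟩, hμ.2⟩ hμ, h.payoff_eq hμ hμ, zero_mul] at this
      exact nonneg_of_mul_nonneg_right this hα
    refine ⟨fun a ha => ?_, h0, fun h1 => le_antisymm ?_ h0⟩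
    · have hd := isMixed_dirac ha hμ.1
      have := hN α _ hd
      rw [h.payoff_eq hd hμ, h.payoff_eq hμ hμ, integral_dirac] at this
      exact le_of_mul_le_mul_left this hα
    · have := hN 1 μ ⟨⟨zero_le_one, le_rfl⟩, hμ.2⟩
      rw [h.payoff_eq ⟨⟨zero_le_one, le_rfl⟩, hμ.2⟩ hμ, h.payoff_eq hμ hμ, ← hC] at this
      by_contra! hpos
      nlinarith
  · rintro ⟨h1, h0, h2⟩
    refine ⟨hμ, fun β ν hν => ?_⟩
    have := hν.2.1
    rw [h.payoff_eq hν hμ, h.payoff_eq hμ hμ, ← hC]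
    have h3 : ∫ a, P.actionPayoff α μ a ∂ν ≤ C := by
      have := integral_mono_ae (h.integrable_actionPayoff hν hμ) (integrable_const C) (by
        filter_upwards [compl_mem_ae_iff.2 hν.2.2] with a ha
        exact h1 a (not_not.1 ha))
      simpa using this
    have h4 : β * ∫ a, P.actionPayoff α μ a ∂ν ≤ β * C := mul_le_mul_of_nonneg_left h3 hν.1.1
    rcases hμ.1.2.lt_or_eq with hlt | heq
    · rw [h2 hlt] at h4 ⊢; simpa using h4
    · exact h4.trans ((mul_le_mul_of_nonneg_right hν.1.2 h0).trans_eq (by rw [heq]))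

end Fubini

end Pool

/-! ### Strategies as curves in the normalized fee distance. -/

namespace Pool

/-- The strategy `S` is described by the density `w` and the relative trading amount `X`, as
functions of the normalized distance in `[0, T]` from the highest gas fee `gL + LB * T`. -/
structure Represents (P : Pool) (b gL T : ℝ) (w X : ℝ → ℝ) (S : Strategy) : Prop where
  T_pos : 0 < T
  gH_le : gL + P.LB * T ≤ P.gHat
  continuous_density : Continuous w
  density_nonneg : ∀ r, 0 ≤ w r
  continuous_amount : Continuous X
  amount_mem : ∀ r, X r ∈ Icc 0 b
  alpha_mem : S.α ∈ Ioc (0 : ℝ) 1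
  isProb : IsProbabilityMeasure S.Φ
  Φ_eq : S.Φ = (volume.restrict (Icc gL (gL + P.LB * T))).withDensity fun g =>
    ENNReal.ofReal ((S.α * P.LB)⁻¹ * w ((gL + P.LB * T - g) / P.LB))
  D_eq : ∀ g ∈ Icc gL (gL + P.LB * T), S.D g = P.yA * X ((gL + P.LB * T - g) / P.LB)

variable {P : Pool} {b gL T : ℝ} {w X : ℝ → ℝ} {S : Strategy}

lemma Represents.gL_le (h : P.HasSize b) (R : P.Represents b gL T w X S) :
    gL ≤ gL + P.LB * T := by
  have := mul_pos h.LB_pos R.T_pos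
  linarith

lemma mem_Icc_of_mem (h : P.HasSize b) {s : ℝ} (hs : s ∈ Icc 0 T) :
    gL + P.LB * T - P.LB * s ∈ Icc gL (gL + P.LB * T) := by
  have h1 := mul_nonneg h.LB_pos.le hs.1
  have h2 := mul_le_mul_of_nonneg_left hs.2 h.LB_pos.le
  constructor <;> linarith

lemma div_mem_of_mem (h : P.HasSize b) {g : ℝ} (hg : g ∈ Icc gL (gL + P.LB * T)) :
    (gL + P.LB * T - g) / P.LB ∈ Icc 0 T := by
  refine ⟨div_nonneg (by linarith [hg.2]) h.LB_pos.le, (div_le_iff₀ h.LB_pos).2 ?_⟩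
  linarith [hg.1]

/-- The factor `α` is absorbed so that `w` is the unconditional density, of total mass `α`. -/
lemma Represents.integral_fee (h : P.HasSize b) (R : P.Represents b gL T w X S) (F : ℝ → ℝ) :
    S.α * ∫ g, F g ∂S.Φ = ∫ s in (0 : ℝ)..T, w s * F (gL + P.LB * T - P.LB * s) := by
  have hL := h.LB_pos
  have hα := R.alpha_mem.1
  have hw := R.continuous_density
  rw [R.Φ_eq, integral_withDensity_eq_integral_toReal_smul (by fun_prop)
    (Filter.Eventually.of_forall fun _ => ENNReal.ofReal_lt_top),
    integral_Icc_eq_integral_Ioc, ← intervalIntegral.integral_of_le (R.gL_le h)]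
  have e := intervalIntegral.integral_comp_sub_mul
    (fun g => w ((gL + P.LB * T - g) / P.LB) * F g) (a := 0) (b := T) hL.ne' (gL + P.LB * T)
  have e2 : ∀ s, (gL + P.LB * T - (gL + P.LB * T - P.LB * s)) / P.LB = s := fun s => by
    field_simp; ring
  simp only [e2, mul_zero, sub_zero, add_sub_cancel_right] at e
  rw [e, smul_eq_mul, ← intervalIntegral.integral_const_mul, ← intervalIntegral.integral_const_mul]
  refine intervalIntegral.integral_congr fun g _ => ?_
  have := R.density_nonneg ((gL + P.LB * T - g) / P.LB)
  simp only [smul_eq_mul]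
  rw [ENNReal.toReal_ofReal (by positivity)]
  field_simp

lemma Represents.mass_eq (h : P.HasSize b) (R : P.Represents b gL T w X S) :
    ∫ s in (0 : ℝ)..T, w s = S.α := by
  have := R.isProb
  have e := R.integral_fee h fun _ => 1
  simpa using e.symm

lemma Represents.mass_le (h : P.HasSize b) (R : P.Represents b gL T w X S) {s : ℝ}
    (hs : s ∈ Icc 0 T) : ∫ r in (0 : ℝ)..s, w r ≤ 1 := by
  have := intervalIntegral.integral_mono_interval (μ := volume) le_rfl hs.1 hs.2
    (Filter.Eventually.of_forall R.density_nonneg) (R.continuous_density.intervalIntegrable 0 T)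
  rw [R.mass_eq h] at this
  exact this.trans R.alpha_mem.2

lemma Represents.ae_mem (R : P.Represents b gL T w X S) :
    ∀ᵐ g ∂S.Φ, g ∈ Icc gL (gL + P.LB * T) := by
  rw [R.Φ_eq]
  exact (withDensity_absolutelyContinuous _ _).ae_le (ae_restrict_mem measurableSet_Icc)

lemma Represents.aemeasurable (R : P.Represents b gL T w X S) :
    AEMeasurable (fun g => (g, S.D g)) S.Φ := by
  have := R.continuous_amount
  refine ⟨fun g => (g, P.yA * X ((gL + P.LB * T - g) / P.LB)), by fun_prop, ?_⟩
  filter_upwards [R.ae_mem] with g hg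
  rw [R.D_eq g hg]

lemma Represents.isMixed (h : P.HasSize b) (R : P.Represents b gL T w X S) :
    P.IsMixed gL S.α S.joint := by
  have := R.isProb
  have hy := h.yA_pos
  refine ⟨Ioc_subset_Icc_self R.alpha_mem, Measure.isProbabilityMeasure_map R.aemeasurable, ?_⟩
  have hm : MeasurableSet (P.actions gL) := measurableSet_Icc.prod measurableSet_Icc
  rw [Strategy.joint, Measure.map_apply_of_aemeasurable R.aemeasurable hm.compl]
  refine measure_mono_null (t := {g | ¬ g ∈ Icc gL (gL + P.LB * T)}) (fun g hg hg' => hg ?_)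
    R.ae_mem
  refine ⟨⟨hg'.1, hg'.2.trans R.gH_le⟩, ?_⟩
  have := R.amount_mem ((gL + P.LB * T - g) / P.LB)
  simp only [R.D_eq g hg', h.DHat_eq]
  exact ⟨mul_nonneg hy.le this.1, mul_le_mul_of_nonneg_left this.2 hy.le⟩

/-- The action at normalized distance `s` from the highest gas fee. -/
noncomputable def curve (P : Pool) (gL T : ℝ) (X : ℝ → ℝ) (s : ℝ) : ℝ × ℝ :=
  (gL + P.LB * T - P.LB * s, P.yA * X s)

lemma Represents.integral_joint (h : P.HasSize b) (R : P.Represents b gL T w X S)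
    {F : ℝ × ℝ → ℝ} (hF : AEStronglyMeasurable F S.joint) :
    S.α * ∫ a, F a ∂S.joint = ∫ s in (0 : ℝ)..T, w s * F (P.curve gL T X s) := by
  unfold Strategy.joint at hF ⊢
  rw [integral_map R.aemeasurable hF, R.integral_fee h]
  refine intervalIntegral.integral_congr fun s hs => ?_
  rw [uIcc_of_le R.T_pos.le] at hs
  have hL := h.LB_pos
  have e2 : (gL + P.LB * T - (gL + P.LB * T - P.LB * s)) / P.LB = s := by
    field_simp; ring
  simp only [curve, R.D_eq _ (mem_Icc_of_mem h hs), e2]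

/-- The payoff of an action in terms of the normalized payoff `gain`. -/
lemma Represents.actionPayoff_eq (h : P.HasSize b) (R : P.Represents b gL T w X S) {x σ : ℝ}
    (hx : 0 ≤ x) (hσ : σ ≤ T) :
    P.actionPayoff S.α S.joint (gL + P.LB * T - P.LB * σ, P.yA * x) =
      P.LB * gain b w X x (max σ 0) - (gL + P.LB * T) + P.LB * min σ 0 := by
  set a : ℝ × ℝ := (gL + P.LB * T - P.LB * σ, P.yA * x) with ha
  have hL := h.LB_pos
  have hm : Measurable fun a' => P.contest a a' :=
    P.measurable_contest.comp (f := fun a' : ℝ × ℝ => (a, a')) (by fun_prop)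
  have hw := R.continuous_density
  have hV : Continuous fun s => w s * (revenue x 0 - revenue x (X s)) :=
    hw.mul (continuous_const.sub
      ((continuousOn_revenue hx).comp_continuous R.continuous_amount R.amount_mem))
  have hσ0 : 0 ≤ max σ 0 := le_max_right _ _
  have hσT : max σ 0 ≤ T := max_le hσ R.T_pos.le
  -- The opponent is ahead exactly at distances below `σ`. The tie at `s = σ` is a single point,
  -- null because the fee law has a density. For `σ < 0` the bid exceeds all others: execution is as
  -- at the top, and only the extra fee `-L_B σ` is paid.
  have c1 : ∀ s ∈ Ioo 0 (max σ 0), w s * P.contest a (P.curve gL T X s) =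
      w s * P.RF a.1 a.2 - P.LB * (w s * (revenue x 0 - revenue x (X s))) := fun s hs => by
    have hlt : s < σ := by
      rcases lt_max_iff.1 hs.2 with h | h
      · exact h
      · exact absurd hs.1 h.not_gt
    have h1 : a.1 < (P.curve gL T X s).1 := by
      simp only [ha, curve]
      have := mul_lt_mul_of_pos_left hlt hL
      linarith
    rw [contest, if_neg h1.not_gt, if_neg h1.ne', RS]
    simp only [ha, curve, h.V_eq hx (R.amount_mem s).1]
    ring
  have c2 : ∀ s ∈ Ioo (max σ 0) T, w s * P.contest a (P.curve gL T X s) =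
      w s * P.RF a.1 a.2 := fun s hs => by
    have h1 : (P.curve gL T X s).1 < a.1 := by
      simp only [ha, curve]
      have := mul_lt_mul_of_pos_left ((le_max_left σ 0).trans_lt hs.1) hL
      linarith
    rw [contest, if_pos h1]
  have ae1 : ∀ p q : ℝ, ∀ f g : ℝ → ℝ, p ≤ q → (∀ s ∈ Ioo p q, f s = g s) →
      ∀ᵐ s ∂volume, s ∈ Ioc p q → f s = g s := fun p q f g _ hfg => by
    have : ∀ᵐ s ∂(volume : Measure ℝ), s ≠ q := by
      simp [ae_iff, measure_singleton]
    filter_upwards [this] with s hs hs'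
    exact hfg s ⟨hs'.1, lt_of_le_of_ne hs'.2 hs⟩
  have key : ∀ p q : ℝ, ∀ f g : ℝ → ℝ, p ≤ q → Continuous g → (∀ s ∈ Ioo p q, f s = g s) →
      IntervalIntegrable f volume p q ∧ ∫ s in p..q, f s = ∫ s in p..q, g s :=
    fun p q f g hpq hg hfg => by
      have h1 := ae1 p q f g hpq hfg
      have h2 : g =ᵐ[volume.restrict (uIoc p q)] f := by
        rw [uIoc_of_le hpq, Filter.EventuallyEq, ae_restrict_iff' measurableSet_Ioc]
        filter_upwards [h1] with s hs hs' using (hs hs').symm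
      refine ⟨(hg.intervalIntegrable p q).congr_ae h2, ?_⟩
      refine intervalIntegral.integral_congr_ae ?_
      rw [uIoc_of_le hpq]
      exact h1
  obtain ⟨i1, e1⟩ := key _ _ _ _ hσ0 (by fun_prop) c1
  obtain ⟨i2, e2⟩ := key _ _ _ _ hσT (by fun_prop) c2
  have hmass := R.mass_eq h
  rw [← intervalIntegral.integral_add_adjacent_intervals (hw.intervalIntegrable 0 (max σ 0))
    (hw.intervalIntegrable _ _)] at hmass
  rw [actionPayoff, R.integral_joint h hm.aestronglyMeasurable,
    ← intervalIntegral.integral_add_adjacent_intervals i1 i2, e1, e2,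
    intervalIntegral.integral_sub (Continuous.intervalIntegrable (by fun_prop) _ _)
      (Continuous.intervalIntegrable (by fun_prop) _ _),
    intervalIntegral.integral_const_mul, intervalIntegral.integral_mul_const,
    intervalIntegral.integral_mul_const]
  have e3 : ∫ s in (0 : ℝ)..max σ 0, w s * (revenue x 0 - revenue x (X s)) =
      (∫ s in (0 : ℝ)..max σ 0, w s) * revenue x 0 -
        ∫ s in (0 : ℝ)..max σ 0, w s * revenue x (X s) := by
    rw [← intervalIntegral.integral_mul_const, ← intervalIntegral.integral_sub
      (Continuous.intervalIntegrable (by fun_prop) _ _)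
      ((continuous_weighted hw R.continuous_amount R.amount_mem
        (continuousOn_revenue hx)).intervalIntegrable _ _)]
    simp only [mul_sub]
  have e4 : P.RF a.1 a.2 = P.LB * (revenue x 0 - x * invSq b 0) - (gL + P.LB * T - P.LB * σ) :=
    h.RF_eq hx _
  have e5 : min σ 0 = σ - max σ 0 := by rw [eq_sub_iff_add_eq', max_add_min, add_zero]
  rw [e3, e4, gain, avg, ← hmass, e5]
  ring

end Pool

/-! ### The universal profile, and the description of all equilibria. -/

/-- `x` is the solution of the equilibrium equation, and the integral of `v` along it reaches `1` at
`Z`. -/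
structure IsProfile (b Z : ℝ) (x : ℝ → ℝ) : Prop where
  Z_pos : 0 < Z
  cont : Continuous x
  pos : ∀ s, 0 < x s
  le : ∀ s, x s ≤ b
  lip : ∃ C, ∀ s s', |x s - x s'| ≤ C * |s - s'|
  mass : ∫ s in (0 : ℝ)..Z, v (x s) = 1
  sol : IsSolution ((1 + b) ^ 2) Z x
  unique : ∀ T x', IsSolution ((1 + b) ^ 2) T x' → ∫ s in (0 : ℝ)..T, v (x' s) ≤ 1 →
    EqOn x' x (Icc 0 T)

lemma exists_profile {b : ℝ} (hb : 0 < b) : ∃ Z x, IsProfile b Z x := by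
  obtain ⟨x, Z, h1, h2, h3, h4, h5, h6, h7, h8⟩ := exists_solution hb
  exact ⟨Z, x, h1, h2, h3, h4, h5, h6, h7, h8⟩

namespace IsProfile

variable {b Z : ℝ} {x : ℝ → ℝ}

lemma continuous_v (p : IsProfile b Z x) : Continuous fun s => v (x s) :=
  continuousOn_v.comp_continuous p.cont p.pos

lemma mem_Icc (p : IsProfile b Z x) (s : ℝ) : x s ∈ Icc 0 b := ⟨(p.pos s).le, p.le s⟩

lemma strictMono (p : IsProfile b Z x) : StrictMono fun T => ∫ s in (0 : ℝ)..T, v (x s) :=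
  strictMono_of_hasDerivAt_pos
    (fun s => (p.continuous_v.integral_hasStrictDerivAt 0 s).hasDerivAt) fun s => v_pos (p.pos s)

lemma mass_le_iff (p : IsProfile b Z x) {T : ℝ} : ∫ s in (0 : ℝ)..T, v (x s) ≤ 1 ↔ T ≤ Z := by
  rw [← p.mass]; exact p.strictMono.le_iff_le

lemma mass_eq_iff (p : IsProfile b Z x) {T : ℝ} : ∫ s in (0 : ℝ)..T, v (x s) = 1 ↔ T = Z := by
  rw [← p.mass]; exact p.strictMono.injective.eq_iff

lemma mass_pos (p : IsProfile b Z x) {T : ℝ} (hT : 0 < T) : 0 < ∫ s in (0 : ℝ)..T, v (x s) := by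
  have := p.strictMono hT
  simpa using this

end IsProfile

namespace Pool

variable {P : Pool} {b gL T : ℝ} {w X : ℝ → ℝ} {S : Strategy}

/-- The density and the amount are extended to the line by projecting fees onto the support, which
keeps them continuous everywhere; the density is rescaled by `α * L_B`. -/
lemma InClass.exists_represents (h : P.HasSize b) (hS : P.InClass gL S) :
    ∃ T w X, P.Represents b gL T w X S ∧ S.Φ.support = Icc gL (gL + P.LB * T) := by
  obtain ⟨hα, hp, hD, gH, hgH, hsupp, hDc, φ, hφc, hφ0, hΦ⟩ := hS
  have hL := h.LB_pos
  have hy := h.yA_pos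
  have hle := hgH.1.le
  have hT : gL + P.LB * ((gH - gL) / P.LB) = gH := by field_simp; ring
  have hproj : ∀ s, (projIcc gL gH hle s : ℝ) ∈ Icc gL gH := fun s => (projIcc gL gH hle s).2
  have hback : ∀ g, gH - P.LB * ((gH - g) / P.LB) = g := fun g => by field_simp; ring
  have hDm : ∀ g ∈ Icc gL gH, S.D g ∈ Icc 0 (P.yA * b) := fun g hg => by
    rw [← h.DHat_eq]; exact hD g ⟨hg.1, hg.2.trans hgH.2⟩
  refine ⟨(gH - gL) / P.LB, fun s => S.α * P.LB * φ (projIcc gL gH hle (gH - P.LB * s)),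
    fun s => S.D (projIcc gL gH hle (gH - P.LB * s)) / P.yA, ⟨div_pos (sub_pos.2 hgH.1) hL, ?_,
    ?_, fun s => ?_, ?_, fun s => ?_, hα, hp, ?_, fun g hg => ?_⟩, ?_⟩
  · rw [hT]; exact hgH.2
  · exact continuous_const.mul (hφc.comp_continuous (by fun_prop) fun s => hproj _)
  · exact mul_nonneg (mul_nonneg hα.1.le hL.le) (hφ0 _ (hproj _))
  · exact (hDc.comp_continuous (by fun_prop) fun s => hproj _).div_const _
  · have := hDm _ (hproj (gH - P.LB * s))
    exact ⟨div_nonneg this.1 hy.le, (div_le_iff₀ hy).2 (by linarith [this.2])⟩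
  · rw [hT, hΦ]
    refine withDensity_congr_ae ?_
    filter_upwards [ae_restrict_mem measurableSet_Icc] with g hg
    rw [hback, projIcc_of_mem _ hg, inv_mul_cancel_left₀ (mul_pos hα.1 hL).ne']
  · rw [hT] at hg ⊢
    rw [hback, projIcc_of_mem _ hg]
    field_simp
  · rw [hT, hsupp]

/-- In an equilibrium, every action on the curve is a best reply. -/
lemma Represents.gain_curve_eq (h : P.HasSize b) (R : P.Represents b gL T w X S)
    (hsupp : S.Φ.support = Icc gL (gL + P.LB * T))
    (hN : ∀ a ∈ P.actions gL,
      P.actionPayoff S.α S.joint a ≤ ∫ a, P.actionPayoff S.α S.joint a ∂S.joint) :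
    (∀ s ∈ Icc 0 T, ∀ x ∈ Icc 0 b, P.LB * gain b w X x s - (gL + P.LB * T) ≤
      ∫ a, P.actionPayoff S.α S.joint a ∂S.joint) ∧
    ∀ s ∈ Icc 0 T, P.LB * gain b w X (X s) s - (gL + P.LB * T) =
      ∫ a, P.actionPayoff S.α S.joint a ∂S.joint := by
  set C := ∫ a, P.actionPayoff S.α S.joint a ∂S.joint with hC
  have hL := h.LB_pos
  have hy := h.yA_pos
  have val : ∀ s ∈ Icc 0 T, ∀ x ∈ Icc 0 b,
      P.actionPayoff S.α S.joint (gL + P.LB * T - P.LB * s, P.yA * x) =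
        P.LB * gain b w X x s - (gL + P.LB * T) := fun s hs x hx => by
    rw [R.actionPayoff_eq h hx.1 hs.2, max_eq_left hs.1, min_eq_right hs.1, mul_zero, add_zero]
  have le : ∀ s ∈ Icc 0 T, ∀ x ∈ Icc 0 b,
      P.LB * gain b w X x s - (gL + P.LB * T) ≤ C := fun s hs x hx => by
    rw [← val s hs x hx]
    have hg := mem_Icc_of_mem (gL := gL) h hs
    refine hN _ ⟨⟨hg.1, hg.2.trans R.gH_le⟩, ?_⟩
    rw [h.DHat_eq]
    exact ⟨mul_nonneg hy.le hx.1, mul_le_mul_of_nonneg_left hx.2 hy.le⟩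
  refine ⟨le, ?_⟩
  set H : ℝ → ℝ := fun s => C - (P.LB * gain b w X (X s) s - (gL + P.LB * T)) with hH
  have Hc : Continuous H := continuous_const.sub ((continuous_const.mul
    (continuous_gain R.continuous_density R.continuous_amount R.amount_mem R.continuous_amount
      (fun s => (R.amount_mem s).1) continuous_id)).sub continuous_const)
  have H0 : ∀ s ∈ Icc 0 T, 0 ≤ H s := fun s hs => sub_nonneg.2 (le s hs _ (R.amount_mem s))
  have wHc : Continuous fun s => w s * H s := R.continuous_density.mul Hc
  -- `H` is the shortfall from the mean payoff; it is nonnegative and its `w`-average is zero, so `w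
  -- * H = 0` throughout `[0, T]`.
  have hint : ∫ s in (0 : ℝ)..T, w s * H s = 0 := by
    have e := R.integral_joint h (h.integrable_actionPayoff (R.isMixed h)
      (R.isMixed h)).aestronglyMeasurable
    have e2 : ∫ s in (0 : ℝ)..T, w s * H s = ∫ s in (0 : ℝ)..T,
        (w s * C - w s * P.actionPayoff S.α S.joint (P.curve gL T X s)) := by
      refine intervalIntegral.integral_congr fun s hs => ?_
      rw [uIcc_of_le R.T_pos.le] at hs
      simp only [hH, curve, val s hs _ (R.amount_mem s), mul_sub]
    rw [e2, intervalIntegral.integral_sub, ← e, intervalIntegral.integral_mul_const,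
      R.mass_eq h, sub_self]
    · exact (R.continuous_density.mul continuous_const).intervalIntegrable _ _
    · refine ((R.continuous_density.mul (continuous_const.sub Hc)).intervalIntegrable 0 T
        (u := fun s => w s * (C - H s))).congr ?_
      intro s hs
      rw [uIoc_of_le R.T_pos.le] at hs
      simp only [hH, curve, val s (Ioc_subset_Icc_self hs) _ (R.amount_mem s)]
      ring
  have zero : ∀ s ∈ Icc 0 T, w s * H s = 0 := fun s hs => by
    by_contra hne
    have hpos := (mul_nonneg (R.density_nonneg s) (H0 s hs)).lt_of_ne' hne
    exact (intervalIntegral.integral_pos R.T_pos wHc.continuousOn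
      (fun r hr => mul_nonneg (R.density_nonneg r) (H0 r (Ioc_subset_Icc_self hr)))
      ⟨s, hs, hpos⟩).ne' hint
  intro s hs
  by_contra hne
  have hpos : 0 < H s := (H0 s hs).lt_of_ne' (sub_ne_zero.2 fun h => hne h.symm)
  -- If `H` were positive somewhere, `w` would vanish on a neighbourhood, although that fee lies in
  -- the support.
  have hmem : gL + P.LB * T - P.LB * s ∈ S.Φ.support := by
    rw [hsupp]; exact mem_Icc_of_mem h hs
  have hback : (gL + P.LB * T - (gL + P.LB * T - P.LB * s)) / P.LB = s := by field_simp; ring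
  have hU : IsOpen {g : ℝ | 0 < H ((gL + P.LB * T - g) / P.LB)} :=
    isOpen_lt continuous_const (Hc.comp (by fun_prop))
  have hpos2 := Measure.mem_support_iff_forall _ |>.1 hmem _ (hU.mem_nhds (by
    simp only [mem_ofPred_eq, hback, hpos]))
  refine hpos2.ne' ?_
  rw [R.Φ_eq, withDensity_apply _ hU.measurableSet, Measure.restrict_restrict hU.measurableSet]
  refine (setLIntegral_congr_fun (hU.measurableSet.inter measurableSet_Icc)
    (g := fun _ => 0) fun g hg => ?_).trans (by simp)
  have := zero _ (div_mem_of_mem h hg.2)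
  rcases mul_eq_zero.1 this with h1 | h1
  · simp only [h1, mul_zero, ENNReal.ofReal_zero]
  · exact absurd h1 (ne_of_gt hg.1)

lemma Represents.profit_eq (h : P.HasSize b) (R : P.Represents b gL T w X S) :
    S.profit P = S.α * ∫ a, P.actionPayoff S.α S.joint a ∂S.joint :=
  h.payoff_eq (R.isMixed h) (R.isMixed h)

/-- Equilibria are described by the solution of the equilibrium equation. -/
theorem IsEquilibrium.represents (h : P.HasSize b) {Z : ℝ} {x : ℝ → ℝ} (p : IsProfile b Z x)
    (hE : P.IsEquilibrium gL S) :
    P.Represents b gL (min Z ((P.gHat - gL) / P.LB)) (fun s => v (x s)) x S ∧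
      S.Φ.support = Icc gL (gL + P.LB * min Z ((P.gHat - gL) / P.LB)) ∧
      S.profit P = S.α * (P.gHat - (gL + P.LB * min Z ((P.gHat - gL) / P.LB))) := by
  obtain ⟨T, w, X, R, hsupp⟩ := hE.1.exists_represents h
  have hL := h.LB_pos
  obtain ⟨N1, N2, N3⟩ := (h.isNash_iff (R.isMixed h) R.alpha_mem.1).1 hE.2
  obtain ⟨G1, G2⟩ := R.gain_curve_eq h hsupp N1
  obtain ⟨sol, hwv⟩ := isSolution_of_isMax h.b_pos R.T_pos R.continuous_density R.density_nonneg
    R.continuous_amount R.amount_mem (R.mass_le h (right_mem_Icc.2 R.T_pos.le))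
    fun s hs s' hs' y hy => by
      have := (G1 s' hs' y hy).trans_eq (G2 s hs).symm
      exact le_of_mul_le_mul_left (by linarith) hL
  have hmass : ∫ s in (0 : ℝ)..T, v (X s) = S.α := by
    rw [← R.mass_eq h]
    refine intervalIntegral.integral_congr fun s hs => ?_
    rw [uIcc_of_le R.T_pos.le] at hs
    exact (hwv s hs).symm
  have hXx := p.unique T X sol (hmass.trans_le R.alpha_mem.2)
  have hmass' : ∫ s in (0 : ℝ)..T, v (x s) = S.α := by
    rw [← hmass]
    refine intervalIntegral.integral_congr fun s hs => ?_
    rw [uIcc_of_le R.T_pos.le] at hs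
    simp only [hXx hs]
  have hTZ : T ≤ Z := p.mass_le_iff.1 (hmass'.trans_le R.alpha_mem.2)
  have h0 : (0 : ℝ) ∈ Icc 0 T := left_mem_Icc.2 R.T_pos.le
  -- Evaluation at the top fee identifies the equilibrium value of trading as `gHat - gH`.
  have hC := G2 0 h0
  obtain ⟨C₀, hlip⟩ := p.lip
  have hval := (gain_eq_of_isSolution h.b_pos p.cont p.pos p.le hlip p.mass.le p.sol 0
    ⟨le_rfl, p.Z_pos.le⟩).2
  have hg0 : gain b w X (X 0) 0 = b ^ 2 / (1 + b) ^ 2 := by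
    rw [← hval, hXx h0]
    simp [gain, avg]
  rw [hg0, ← h.gHat_eq] at hC
  have hT : min Z ((P.gHat - gL) / P.LB) = T := by
    have h1 : T ≤ (P.gHat - gL) / P.LB := by
      rw [le_div_iff₀ hL]; linarith [R.gH_le]
    -- Full mass means `T = Z`; otherwise the value of trading is zero, so `gH = gHat`.
    rcases R.alpha_mem.2.eq_or_lt with h2 | h2
    · rw [← p.mass_eq_iff.1 (hmass'.trans h2), min_eq_left h1]
    · have h3 := N3 h2
      rw [← hC] at h3
      have h4 : (P.gHat - gL) / P.LB = T := by
        rw [div_eq_iff hL.ne']; linarith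
      rw [h4, min_eq_right hTZ]
  rw [hT]
  refine ⟨{ R with
    continuous_density := p.continuous_v
    density_nonneg := fun s => (v_pos (p.pos s)).le
    continuous_amount := p.cont
    amount_mem := p.mem_Icc
    Φ_eq := ?_
    D_eq := fun g hg => ?_ }, hsupp, ?_⟩
  · rw [R.Φ_eq]
    refine withDensity_congr_ae ?_
    filter_upwards [ae_restrict_mem measurableSet_Icc] with g hg
    have := div_mem_of_mem h hg
    rw [hwv _ this, hXx this]
  · rw [R.D_eq g hg, hXx (div_mem_of_mem h hg)]
  · rw [Represents.profit_eq h R, hC]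

/-! ### Construction and verification of the equilibrium. -/

/-- The strategy described by the solution `x` of the equilibrium equation. -/
noncomputable def equilibrium (P : Pool) (x : ℝ → ℝ) (gL T : ℝ) : Strategy where
  α := ∫ s in (0 : ℝ)..T, v (x s)
  Φ := (volume.restrict (Icc gL (gL + P.LB * T))).withDensity fun g =>
    ENNReal.ofReal (((∫ s in (0 : ℝ)..T, v (x s)) * P.LB)⁻¹ * v (x ((gL + P.LB * T - g) / P.LB)))
  D := fun g => P.yA * x ((gL + P.LB * T - g) / P.LB)

lemma equilibrium_represents (h : P.HasSize b) {Z : ℝ} {x : ℝ → ℝ} (p : IsProfile b Z x)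
    (hT : 0 < T) (hTZ : T ≤ Z) (hgH : gL + P.LB * T ≤ P.gHat) :
    P.Represents b gL T (fun s => v (x s)) x (P.equilibrium x gL T) where
  T_pos := hT
  gH_le := hgH
  continuous_density := p.continuous_v
  density_nonneg := fun s => (v_pos (p.pos s)).le
  continuous_amount := p.cont
  amount_mem := p.mem_Icc
  alpha_mem := ⟨p.mass_pos hT, p.mass_le_iff.2 hTZ⟩
  isProb := by
    have hL := h.LB_pos
    have hα := p.mass_pos hT
    have hLT := mul_pos hL hT
    have hv := p.continuous_v
    have hc : Continuous fun g => ((∫ s in (0 : ℝ)..T, v (x s)) * P.LB)⁻¹ *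
        v (x ((gL + P.LB * T - g) / P.LB)) :=
      continuous_const.mul (hv.comp (by fun_prop))
    have hnn : ∀ g, 0 ≤ ((∫ s in (0 : ℝ)..T, v (x s)) * P.LB)⁻¹ *
        v (x ((gL + P.LB * T - g) / P.LB)) := fun g => by
      have := v_pos (p.pos ((gL + P.LB * T - g) / P.LB))
      positivity
    constructor
    simp only [equilibrium]
    rw [withDensity_apply _ MeasurableSet.univ, Measure.restrict_univ,
      ← ofReal_integral_eq_lintegral_ofReal (hc.integrableOn_Icc)
        (Filter.Eventually.of_forall hnn), integral_Icc_eq_integral_Ioc,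
      ← intervalIntegral.integral_of_le (by linarith)]
    have e := intervalIntegral.integral_comp_sub_mul
      (fun g => v (x ((gL + P.LB * T - g) / P.LB))) (a := 0) (b := T) hL.ne' (gL + P.LB * T)
    have e2 : ∀ s, (gL + P.LB * T - (gL + P.LB * T - P.LB * s)) / P.LB = s := fun s => by
      field_simp; ring
    simp only [e2, mul_zero, sub_zero, add_sub_cancel_right, smul_eq_mul] at e
    rw [intervalIntegral.integral_const_mul, mul_inv, mul_assoc, ← e, inv_mul_cancel₀ hα.ne',
      ENNReal.ofReal_one]
  Φ_eq := rfl
  D_eq := fun _ _ => rfl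

/-- The density is strictly positive, so Lebesgue measure on the interval is absolutely continuous
with respect to the fee law. -/
lemma equilibrium_support (h : P.HasSize b) {Z : ℝ} {x : ℝ → ℝ} (p : IsProfile b Z x)
    (hT : 0 < T) : (P.equilibrium x gL T).Φ.support = Icc gL (gL + P.LB * T) := by
  have hL := h.LB_pos
  have hα := p.mass_pos hT
  have hLT := mul_pos hL hT
  have hv := p.continuous_v
  have hpos : ∀ g, 0 < ((∫ s in (0 : ℝ)..T, v (x s)) * P.LB)⁻¹ *
      v (x ((gL + P.LB * T - g) / P.LB)) := fun g => by
    have := v_pos (p.pos ((gL + P.LB * T - g) / P.LB))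
    positivity
  have hc : Continuous fun g => ((∫ s in (0 : ℝ)..T, v (x s)) * P.LB)⁻¹ *
      v (x ((gL + P.LB * T - g) / P.LB)) :=
    continuous_const.mul (hv.comp (by fun_prop))
  refine subset_antisymm (Measure.support_subset_of_isClosed isClosed_Icc ?_) ?_
  · exact (withDensity_absolutelyContinuous _ _).ae_le (ae_restrict_mem measurableSet_Icc)
  · have h1 : volume.restrict (Icc gL (gL + P.LB * T)) ≪ (P.equilibrium x gL T).Φ :=
      withDensity_absolutelyContinuous' hc.measurable.ennreal_ofReal.aemeasurable
        (Filter.Eventually.of_forall fun g => (ENNReal.ofReal_pos.2 (hpos g)).ne')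
    have h2 : Ioo gL (gL + P.LB * T) ⊆ (P.equilibrium x gL T).Φ.support := fun g hg =>
      Measure.AbsolutelyContinuous.support_mono h1 (Measure.interior_inter_support
        ⟨by rwa [interior_Icc], by rw [Measure.support_eq_univ]; trivial⟩)
    have h3 := closure_minimal h2 Measure.isClosed_support
    rwa [closure_Ioo (by linarith)] at h3

theorem equilibrium_isEquilibrium (h : P.HasSize b) {Z : ℝ} {x : ℝ → ℝ} (p : IsProfile b Z x)
    (hgL : gL < P.gHat) :
    P.IsEquilibrium gL (P.equilibrium x gL (min Z ((P.gHat - gL) / P.LB))) := by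
  have hL := h.LB_pos
  have hy := h.yA_pos
  set T := min Z ((P.gHat - gL) / P.LB) with hT
  have hT0 : 0 < T := lt_min p.Z_pos (div_pos (sub_pos.2 hgL) hL)
  have hTZ : T ≤ Z := min_le_left _ _
  have hgH : gL + P.LB * T ≤ P.gHat := by
    have : T ≤ (P.gHat - gL) / P.LB := min_le_right _ _
    rw [le_div_iff₀ hL] at this
    linarith
  have hLT := mul_pos hL hT0
  have R := equilibrium_represents h p hT0 hTZ hgH
  set S := P.equilibrium x gL T with hS
  obtain ⟨C₀, hlip⟩ := p.lip
  have G := gain_eq_of_isSolution h.b_pos p.cont p.pos p.le hlip p.mass.le p.sol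
  have hint : ∫ a, P.actionPayoff S.α S.joint a ∂S.joint = P.gHat - (gL + P.LB * T) := by
    have e := R.integral_joint h (h.integrable_actionPayoff (R.isMixed h)
      (R.isMixed h)).aestronglyMeasurable
    have e2 : ∫ s in (0 : ℝ)..T, v (x s) * P.actionPayoff S.α S.joint (P.curve gL T x s) =
        ∫ s in (0 : ℝ)..T, v (x s) * (P.gHat - (gL + P.LB * T)) := by
      refine intervalIntegral.integral_congr fun s hs => ?_
      rw [uIcc_of_le hT0.le] at hs
      simp only [curve]
      rw [R.actionPayoff_eq h (p.pos s).le hs.2, max_eq_left hs.1, min_eq_right hs.1,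
        (G s ⟨hs.1, hs.2.trans hTZ⟩).2, h.gHat_eq]
      ring
    rw [e2, intervalIntegral.integral_mul_const, R.mass_eq h] at e
    exact mul_left_cancel₀ R.alpha_mem.1.ne' e
  refine ⟨⟨R.alpha_mem, R.isProb, fun g _ => ?_, gL + P.LB * T, ⟨by linarith, hgH⟩,
    equilibrium_support h p hT0, ?_, _, ?_, ?_, R.Φ_eq⟩,
    (h.isNash_iff (R.isMixed h) R.alpha_mem.1).2 ⟨fun a ha => ?_, ?_, fun h1 => ?_⟩⟩
  · rw [h.DHat_eq]
    have := p.mem_Icc ((gL + P.LB * T - g) / P.LB)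
    exact ⟨mul_nonneg hy.le this.1, mul_le_mul_of_nonneg_left this.2 hy.le⟩
  · exact (continuous_const.mul (p.cont.comp (by fun_prop))).continuousOn
  · exact (continuous_const.mul (p.continuous_v.comp (by fun_prop))).continuousOn
  · intro g _
    have := v_pos (p.pos ((gL + P.LB * T - g) / P.LB))
    have := R.alpha_mem.1
    positivity
  · obtain ⟨g, d⟩ := a
    obtain ⟨⟨hg1, hg2⟩, hd1, hd2⟩ := ha
    simp only at hg1 hg2 hd1 hd2
    set σ := (gL + P.LB * T - g) / P.LB with hσ
    have hσT : σ ≤ T := by rw [hσ, div_le_iff₀ hL]; linarith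
    have eg : g = gL + P.LB * T - P.LB * σ := by rw [hσ]; field_simp; ring
    have ed : d = P.yA * (d / P.yA) := by field_simp
    have hx0 : 0 ≤ d / P.yA := div_nonneg hd1 hy.le
    have hxb : d / P.yA ≤ b := by
      rw [div_le_iff₀ hy, mul_comm, ← h.DHat_eq]; exact hd2
    rw [hint, eg, ed, R.actionPayoff_eq h hx0 hσT, h.gHat_eq]
    -- A bid above the top fee is dominated by the top fee itself, so the bound on `[0, Z]` covers
    -- every deviation.
    have h1 := (G (max σ 0) ⟨le_max_right _ _, max_le (hσT.trans hTZ) p.Z_pos.le⟩).1 _ ⟨hx0, hxb⟩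
    have h2 := mul_le_mul_of_nonneg_left h1 hL.le
    have h3 : P.LB * min σ 0 ≤ 0 := mul_nonpos_of_nonneg_of_nonpos hL.le (min_le_right _ _)
    linarith
  · rw [hint]; linarith
  · rw [hint]
    -- A mass below `1` excludes `T = Z`, so the highest fee is `gHat` and the value of trading is
    -- zero.
    have hne : T ≠ Z := fun hTe => h1.ne (p.mass_eq_iff.2 hTe)
    have h2 : T = (P.gHat - gL) / P.LB := by
      rcases min_choice Z ((P.gHat - gL) / P.LB) with h3 | h3
      · exact absurd (hT.trans h3) hne
      · exact hT.trans h3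
    rw [h2]
    field_simp
    ring

end Pool

/-! ### Unconditional laws and their comparison along the common profile. -/

namespace Pool

variable {P : Pool} {b gL T : ℝ} {w X : ℝ → ℝ} {S : Strategy}

lemma measurable_curve (hX : Continuous X) : Measurable (P.curve gL T X) := by
  unfold curve
  fun_prop

lemma intervalIntegrable_indicator_curve (hw : Continuous w) (hX : Continuous X)
    {A : Set (ℝ × ℝ)} (hA : MeasurableSet A) (p q : ℝ) :
    IntervalIntegrable (fun s => w s * A.indicator 1 (P.curve gL T X s)) volume p q := by
  have e : (fun s => w s * A.indicator 1 (P.curve gL T X s)) =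
      (P.curve gL T X ⁻¹' A).indicator w := by
    ext s
    by_cases hs : P.curve gL T X s ∈ A
    · simp [hs]
    · simp [hs]
  have hm := measurable_curve (P := P) (gL := gL) (T := T) hX hA
  have := hw.intervalIntegrable (μ := volume) p q
  rw [e]
  exact ⟨this.1.indicator hm, this.2.indicator hm⟩

lemma Represents.law_real (h : P.HasSize b) (R : P.Represents b gL T w X S) {A : Set (ℝ × ℝ)}
    (hA : MeasurableSet A) :
    S.law.real A = (1 - S.α) * A.indicator 1 (0, 0) +
      ∫ s in (0 : ℝ)..T, w s * A.indicator 1 (P.curve gL T X s) := by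
  have := (R.isMixed h).2.1
  have e : S.joint.real A = ∫ a, A.indicator (1 : ℝ × ℝ → ℝ) a ∂S.joint := by
    rw [integral_indicator_one hA]
  have e2 : (Measure.dirac ((0 : ℝ), (0 : ℝ))).real A = A.indicator 1 (0, 0) := by
    rw [measureReal_def, Measure.dirac_apply' _ hA]
    by_cases h0 : ((0 : ℝ), (0 : ℝ)) ∈ A <;> simp [h0]
  have f1 := (Measure.dirac ((0 : ℝ), (0 : ℝ))).smul_finite (ENNReal.ofReal_ne_top (r := 1 - S.α))
  have f2 := S.joint.smul_finite (ENNReal.ofReal_ne_top (r := S.α))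
  rw [Strategy.law, measureReal_add_apply (measure_ne_top _ _) (measure_ne_top _ _),
    measureReal_ennreal_smul_apply,
    measureReal_ennreal_smul_apply, ENNReal.toReal_ofReal (by linarith [R.alpha_mem.2]),
    ENNReal.toReal_ofReal R.alpha_mem.1.le, e, e2, R.integral_joint h
      (measurable_one.indicator hA).aestronglyMeasurable]

lemma Represents.law_real_eq_one (h : P.HasSize b) (R : P.Represents b gL T w X S)
    {A : Set (ℝ × ℝ)} (hA : MeasurableSet A) (h0 : ((0 : ℝ), (0 : ℝ)) ∈ A)
    (h1 : ∀ s ∈ Icc 0 T, P.curve gL T X s ∈ A) : S.law.real A = 1 := by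
  have e : ∫ s in (0 : ℝ)..T, w s * A.indicator 1 (P.curve gL T X s) =
      ∫ s in (0 : ℝ)..T, w s := by
    refine intervalIntegral.integral_congr fun s hs => ?_
    rw [uIcc_of_le R.T_pos.le] at hs
    simp [h1 s hs]
  rw [R.law_real h hA, e, R.mass_eq h, indicator_of_mem h0]
  simp

lemma measurableSet_fee (g : ℝ) : MeasurableSet {p : ℝ × ℝ | g < p.1} :=
  measurableSet_lt measurable_const measurable_fst

lemma measurableSet_amount (P : Pool) (d : ℝ) : MeasurableSet {p : ℝ × ℝ | d < p.2 / P.yA} :=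
  measurableSet_lt measurable_const (measurable_snd.div_const _)

variable {gL₁ gL₂ T₁ T₂ : ℝ} {S₁ S₂ : Strategy}

/-- If the first curve meets `A` less often, then so does the first strategy. -/
lemma Represents.law_real_mono (h : P.HasSize b) (R₁ : P.Represents b gL₁ T₁ w X S₁)
    (R₂ : P.Represents b gL₂ T₂ w X S₂) (hT : T₁ ≤ T₂) {A : Set (ℝ × ℝ)} (hA : MeasurableSet A)
    (hα : S₁.α = 1 ∧ S₂.α = 1 ∨ ((0 : ℝ), (0 : ℝ)) ∉ A)
    (hc : ∀ s, P.curve gL₁ T₁ X s ∈ A → P.curve gL₂ T₂ X s ∈ A) :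
    S₁.law.real A ≤ S₂.law.real A := by
  have e : ∀ S : Strategy, (S = S₁ ∨ S = S₂) → 
      (1 - S.α) * A.indicator 1 ((0 : ℝ), (0 : ℝ)) = 0 := by
    intro S hS
    rcases hα with ⟨h1, h2⟩ | h0
    · rcases hS with rfl | rfl <;> simp [h1, h2]
    · simp [h0]
  rw [R₁.law_real h hA, R₂.law_real h hA, e _ (Or.inl rfl), e _ (Or.inr rfl), zero_add, zero_add]
  have hind : ∀ s, (0 : ℝ) ≤ A.indicator 1 (P.curve gL₂ T₂ X s) := fun s =>
    indicator_nonneg (fun _ _ => zero_le_one) _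
  have i2 := intervalIntegrable_indicator_curve (P := P) (gL := gL₂) (T := T₂)
    R₁.continuous_density R₁.continuous_amount hA
  refine (intervalIntegral.integral_mono_on R₁.T_pos.le (intervalIntegrable_indicator_curve
    R₁.continuous_density R₁.continuous_amount hA _ _) (i2 _ _) fun s _ => ?_).trans
    (intervalIntegral.integral_mono_interval le_rfl R₁.T_pos.le hT
      (Filter.Eventually.of_forall fun s => mul_nonneg (R₁.density_nonneg s) (hind s)) (i2 _ _))
  refine mul_le_mul_of_nonneg_left ?_ (R₁.density_nonneg s)
  by_cases hs : P.curve gL₁ T₁ X s ∈ A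
  · simp [hs, hc s hs]
  · simpa [hs] using hind s

end Pool

end GasGame

/-! ### Assembly of existence, uniqueness, the threshold and the comparative statics. -/

open GasGame in
theorem mainTheorem7 (P : Pool)
    (hyA : 0 < P.yA) (hyB : 0 < P.yB) (hpA : 0 < P.pA) (hpB : 0 < P.pB) (hf : 0 ≤ P.f)
    (hO : 1 < P.opp) (hO3 : P.opp ≤ 3) :
    -- for each base gas fee there is a unique equilibrium in the class
    (∀ gL : ℝ, 0 ≤ gL → gL < P.gHat →
      ∃ S : Strategy, P.IsEquilibrium gL S ∧
        ∀ S' : Strategy, P.IsEquilibrium gL S' →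
          S'.α = S.α ∧ S'.Φ = S.Φ ∧ Set.EqOn S'.D S.D S.Φ.support) ∧
    -- the threshold between the two regimes
    (∃ z : ℝ, IsZHat P.opp z ∧ (∀ z' : ℝ, IsZHat P.opp z' → z' = z) ∧
      ∀ (gL : ℝ) (S : Strategy), 0 ≤ gL → gL < P.gHat → P.IsEquilibrium gL S →
        (S.α = 1 ↔ gL ≤ P.gHat - P.LB * z) ∧ (S.α < 1 ↔ P.gHat - P.LB * z < gL)) ∧
    -- comparison of the equilibria for two base gas fees
    (∀ (gL₁ gL₂ : ℝ) (S₁ S₂ : Strategy), 0 ≤ gL₁ → gL₁ < gL₂ → gL₂ < P.gHat →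
      P.IsEquilibrium gL₁ S₁ → P.IsEquilibrium gL₂ S₂ →
        (S₂.α ≤ S₁.α ∧ (S₂.α < 1 → S₂.α < S₁.α)) ∧
        (S₂.profit P ≤ S₁.profit P ∧ (0 < S₁.profit P → S₂.profit P < S₁.profit P)) ∧
        ((S₁.α = 1 → S₂.α = 1 → ∀ g : ℝ, S₁.feeTail g ≤ S₂.feeTail g) ∧
          (S₁.α < 1 → S₂.α < 1 → ∀ g : ℝ, S₂.feeTail g ≤ S₁.feeTail g)) ∧
        ((S₁.α = 1 → S₂.α = 1 → ∀ d : ℝ, S₁.amountTail P d = S₂.amountTail P d) ∧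
          (S₁.α < 1 → S₂.α < 1 → ∀ d : ℝ, S₂.amountTail P d ≤ S₁.amountTail P d))) := by
  have h := Pool.hasSize hyA hyB hpA hpB hf hO
  set b := Real.sqrt P.opp - 1 with hb
  have hopp : P.opp = (1 + b) ^ 2 := by
    rw [hb, add_sub_cancel, Real.sq_sqrt (by linarith)]
  have hL := h.LB_pos
  obtain ⟨Z, x, p⟩ := exists_profile h.b_pos
  have hα : ∀ (gL : ℝ) (S : Strategy), P.IsEquilibrium gL S →
      S.α = ∫ s in (0 : ℝ)..min Z ((P.gHat - gL) / P.LB), v (x s) := fun gL S hE =>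
    ((hE.represents h p).1.mass_eq h).symm
  have hα1 : ∀ (gL : ℝ) (S : Strategy), P.IsEquilibrium gL S →
      (S.α = 1 ↔ Z ≤ (P.gHat - gL) / P.LB) := fun gL S hE => by
    rw [hα gL S hE, p.mass_eq_iff, min_eq_left_iff]
  have hα2 : ∀ (gL : ℝ) (S : Strategy), P.IsEquilibrium gL S →
      (S.α < 1 ↔ (P.gHat - gL) / P.LB < Z) := fun gL S hE => by
    rw [lt_iff_le_and_ne, Ne, hα1 gL S hE, not_le]
    exact and_iff_right hE.1.1.2
  refine ⟨fun gL _ hgL => ?_, ⟨Z, ?_, fun z' hz' => ?_, fun gL S _ _ hE => ?_⟩,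
    fun gL₁ gL₂ S₁ S₂ h1 h12 h2 E₁ E₂ => ?_⟩
  · have hE := Pool.equilibrium_isEquilibrium h p hgL
    refine ⟨_, hE, fun S' hE' => ?_⟩
    obtain ⟨R, supp, -⟩ := hE.represents h p
    obtain ⟨R', -, -⟩ := hE'.represents h p
    have ha := (hα gL S' hE').trans (hα gL _ hE).symm
    refine ⟨ha, ?_, fun g hg => ?_⟩
    · rw [R'.Φ_eq, R.Φ_eq, ha]
    · rw [supp] at hg
      rw [R'.D_eq g hg, R.D_eq g hg]
  · exact ⟨p.Z_pos, x, by rw [hopp]; exact p.sol, p.mass⟩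
  · obtain ⟨hz0, x', sol, hm⟩ := hz'
    rw [hopp] at sol
    rw [← p.mass_eq_iff, ← hm]
    refine intervalIntegral.integral_congr fun s hs => ?_
    rw [Set.uIcc_of_le hz0.le] at hs
    simp only [p.unique _ _ sol hm.le hs]
  · rw [hα1 gL S hE, hα2 gL S hE, le_div_iff₀ hL, div_lt_iff₀ hL]
    constructor <;> constructor <;> intro _ <;> linarith
  have hlt : (P.gHat - gL₂) / P.LB < (P.gHat - gL₁) / P.LB := by gcongr
  have hTle : min Z ((P.gHat - gL₂) / P.LB) ≤ min Z ((P.gHat - gL₁) / P.LB) :=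
    min_le_min_left _ hlt.le
  obtain ⟨R₁, -, pr₁⟩ := E₁.represents h p
  obtain ⟨R₂, -, pr₂⟩ := E₂.represents h p
  have hpr : ∀ gL, (P.gHat - gL) / P.LB < Z →
      P.gHat - (gL + P.LB * min Z ((P.gHat - gL) / P.LB)) = 0 := fun gL hg => by
    rw [min_eq_right hg.le, mul_div_cancel₀ _ hL.ne']; ring
  have one : ∀ {S : Strategy} {gL : ℝ}, P.IsEquilibrium gL S → S.α = 1 →
      min Z ((P.gHat - gL) / P.LB) = Z := fun hE hS => min_eq_left ((hα1 _ _ hE).1 hS)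
  have lt_one : ∀ {S : Strategy} {gL : ℝ}, P.IsEquilibrium gL S → S.α < 1 →
      gL + P.LB * min Z ((P.gHat - gL) / P.LB) = P.gHat := fun hE hS => by
    linarith [hpr _ ((hα2 _ _ hE).1 hS)]
  refine ⟨⟨?_, fun hS => ?_⟩, ?_, ⟨fun hS₁ hS₂ g => ?_, fun hS₁ hS₂ g => ?_⟩,
    ⟨fun hS₁ hS₂ d => ?_, fun hS₁ hS₂ d => ?_⟩⟩
  · rw [hα _ _ E₁, hα _ _ E₂]
    exact p.strictMono.monotone hTle
  · rw [hα _ _ E₁, hα _ _ E₂]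
    have := (hα2 _ _ E₂).1 hS
    exact p.strictMono (by rw [min_eq_right this.le]; exact lt_min this hlt)
  · have nonneg₁ : 0 ≤ S₁.profit P := by
      rw [pr₁]; exact mul_nonneg R₁.alpha_mem.1.le (sub_nonneg.2 R₁.gH_le)
    rcases R₂.alpha_mem.2.lt_or_eq with hS | hS
    · have h0 : S₂.profit P = 0 := by rw [pr₂, hpr _ ((hα2 _ _ E₂).1 hS), mul_zero]
      rw [h0]
      exact ⟨nonneg₁, id⟩
    · have hZ₂ := (hα1 _ _ E₂).1 hS
      have hZ₁ := hZ₂.trans hlt.le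
      have hS₁ := (hα1 _ _ E₁).2 hZ₁
      rw [pr₁, pr₂, hS, hS₁, min_eq_left hZ₁, min_eq_left hZ₂]
      exact ⟨by linarith, fun _ => by linarith⟩
  -- With both curves of full length `Z`, raising the base fee translates every fee upwards.
  · refine R₁.law_real_mono h R₂ (by rw [one E₁ hS₁, one E₂ hS₂]) (Pool.measurableSet_fee g)
      (Or.inl ⟨hS₁, hS₂⟩) fun s hs => ?_
    simp only [Pool.curve, one E₁ hS₁, one E₂ hS₂, Set.mem_ofPred_eq] at hs ⊢
    linarith
  -- For `g < 0` both tails equal `1`, since base fees are nonnegative and not trading counts as fee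
  -- `0`. For `g ≥ 0` not trading does not contribute; both curves start at `gHat` and agree, and a
  -- higher base fee only shortens the curve.
  · rcases lt_or_ge g 0 with hg | hg
    · have : ∀ {S : Strategy} {gL T : ℝ}, 0 ≤ gL → P.Represents b gL T (fun s => v (x s)) x S →
          S.feeTail g = 1 := fun hgL R =>
        R.law_real_eq_one h (Pool.measurableSet_fee g) hg fun s hs =>
          (hg.trans_le hgL).trans_le (Pool.mem_Icc_of_mem h hs).1
      rw [this h1 R₁, this (h1.trans h12.le) R₂]
    · refine R₂.law_real_mono h R₁ hTle (Pool.measurableSet_fee g)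
        (Or.inr (by simpa using hg)) fun s hs => ?_
      simpa only [Pool.curve, lt_one E₁ hS₁, lt_one E₂ hS₂] using hs
  -- Amounts depend only on the distance from the top, so equal lengths give equal laws.
  · have hT : min Z ((P.gHat - gL₁) / P.LB) = min Z ((P.gHat - gL₂) / P.LB) := by
      rw [one E₁ hS₁, one E₂ hS₂]
    exact le_antisymm
      (R₁.law_real_mono h R₂ hT.le (P.measurableSet_amount d) (Or.inl ⟨hS₁, hS₂⟩) fun s hs => hs)
      (R₂.law_real_mono h R₁ hT.ge (P.measurableSet_amount d) (Or.inl ⟨hS₂, hS₁⟩) fun s hs => hs)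
  · rcases lt_or_ge d 0 with hd | hd
    · have : ∀ {S : Strategy} {gL T : ℝ}, P.Represents b gL T (fun s => v (x s)) x S →
          S.amountTail P d = 1 := fun R =>
        R.law_real_eq_one h (P.measurableSet_amount d) (by simpa using hd) fun s hs =>
          hd.trans_le (div_nonneg (mul_nonneg hyA.le (p.pos s).le) hyA.le)
      rw [this R₁, this R₂]
    · exact R₂.law_real_mono h R₁ hTle (P.measurableSet_amount d)
        (Or.inr (by simpa using hd)) fun s hs => hs
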